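/- Let $M$ be a commutative monoid that is sharp ($0$ is its only invertible element) and integral (cancellative), with groupification $M^{gp}$. A graph here is a non-empty, finite, connected, undirected multigraph, with loops and parallel edges allowed. Let $\Gamma$ be an $M$-metrised graph, i.e. a graph $G=(V,E)$ (the underlying graph of $\Gamma$) together with a non-zero length $l(e)\in M$ for every edge $e$. A divisor on $\Gamma$ is a function $D:V\to\mathbb Z$; its degree is $\deg D=\sum_{v}D(v)$, and it is effective if $D\ge 0$. A function $g:V\to M^{gp}$ is piecewise linear if for every edge $e$ with ends $u,v$ the difference $g(u)-g(v)$ is an integer multiple of $l(e)$. Its Laplacian is the divisor $\Delta(g)$ whose value at $v$ is $\sum_e \frac{g(v)-g(w_e)}{l(e)}$, the sum being over the half-edges at $v$, where $w_e$ is the other end of the edge. Divisors $D,D'$ are linearly equivalent if $D-D'=\Delta(g)$ for some piecewise linear $g$, and $|D|$ is the set of effective divisors linearly equivalent to $D$. The rank $r(D)$ is the maximal $k\in\mathbb Z$ such that $|D-F|\ne\emptyset$ for all effective divisors $F$ of degree $k$. The divisorial gonality is $$\operatorname{dgon}(\Gamma)=\min\{\deg D : r(D)\ge 1\}.$$ A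 scramble in $G$ is a set $\mathcal S$ of non-empty connected subsets of $V$, called eggs. Its order is the maximal integer $k\ge 0$ such that (1) every $C\subseteq V$ that meets all eggs has at least $k$ elements, and (2) for every $A\subseteq V$ such that some egg is contained in $A$ and some egg is contained in $V\setminus A$, there are at least $k$ edges between $A$ and $V\setminus A$. The scramble number $\operatorname{sn}(G)$ is the maximal order of a scramble in $G$. The treewidth $\operatorname{tw}(G)$ is the minimal width of a tree decomposition of $G$, i.e. of a finite tree $T$ with sets $B_t\subseteq V$ for the nodes $t$ of $T$, such that the ends of every edge of $G$ lie in a common $B_t$, and such that for every $v\in V$ the nodes $t$ with $v\in B_t$ induce a non-empty connected subgraph of $T$; its width is $\max_t|B_t|-1$. Then $$\operatorname{dgon}(\Gamma)\ \ge\ \operatorname{sn}(G)\ \ge\ \operatorname{tw}(G).$$ -/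

import Mathlib

/-- A finite undirected multigraph (loops and parallel edges allowed) on a set `X` of vertices and
half-edges. The fixed points of the involution `i` are the vertices, the other elements are the
half-edges; `r e` is the vertex at which the half-edge `e` is attached, and `i e` is the other half
of the edge containing `e`. -/
structure HalfEdgeGraph (X : Type*) where
  r : X → X
  i : X → X
  r_idem : ∀ x, r (r x) = r x
  i_invol : ∀ x, i (i x) = x
  i_eq_iff : ∀ x, i x = x ↔ r x = x

namespace HalfEdgeGraph

/-- The type of vertices. -/
abbrev V {X : Type*} (G : HalfEdgeGraph X) : Type _ := {x : X // G.i x = x}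

/-- The map `r`, with values in the type of vertices. -/
def root {X : Type*} (G : HalfEdgeGraph X) (x : X) : G.V :=
  ⟨G.r x, (G.i_eq_iff _).2 (G.r_idem x)⟩

/-- The simple graph of adjacency between distinct vertices; only used to speak about
connectedness. -/
def adjGraph {X : Type*} (G : HalfEdgeGraph X) : SimpleGraph G.V where
  Adj u v := u ≠ v ∧ ∃ e : X, G.i e ≠ e ∧ G.root e = u ∧ G.root (G.i e) = v
  symm := ⟨by
    rintro u v ⟨huv, e, he, hu, hv⟩
    refine ⟨huv.symm, G.i e, fun h => he ?_, hv, ?_⟩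
    · rw [G.i_invol] at h; exact h.symm
    · rw [G.i_invol]; exact hu⟩
  loopless := ⟨fun _ h => h.1 rfl⟩

/-- The graph is connected (and has at least one vertex). -/
def Connected {X : Type*} (G : HalfEdgeGraph X) : Prop := G.adjGraph.Connected

/-- A set of vertices is connected if it is non-empty and induces a connected subgraph. -/
def ConnectedSet {X : Type*} (G : HalfEdgeGraph X) (S : Set G.V) : Prop :=
  (G.adjGraph.induce S).Connected

/-- The half-edges adjacent to the vertex `v`. -/
def halfEdgesAt {X : Type*} [Fintype X] [DecidableEq X] (G : HalfEdgeGraph X) (v : G.V) :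
    Finset X :=
  Finset.univ.filter fun e => G.i e ≠ e ∧ G.root e = v

/-! ### Scramble number -/

/-- The number of edges between `A` and its complement, counted with multiplicity. Every such edge
has exactly one half-edge attached in `A`, and that half-edge represents it here. -/
noncomputable def cutSize {X : Type*} (G : HalfEdgeGraph X) (A : Set G.V) : ℕ :=
  {e : X | G.i e ≠ e ∧ G.root e ∈ A ∧ G.root (G.i e) ∉ A}.ncard

/-- A scramble is a set of (non-empty) connected vertex sets, called eggs. -/
structure Scramble {X : Type*} (G : HalfEdgeGraph X) where
  eggs : Set (Set G.V)
  connected : ∀ E ∈ eggs, G.ConnectedSet E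

/-- The numbers `k` such that every hitting set has at least `k` elements, and every edge cut
with an egg on either side has at least `k` edges. -/
def Scramble.orderSet {X : Type*} {G : HalfEdgeGraph X} (S : G.Scramble) : Set ℕ :=
  {k | (∀ C : Finset G.V, (∀ E ∈ S.eggs, ∃ v ∈ C, v ∈ E) → k ≤ C.card) ∧
    ∀ A : Set G.V, (∃ E ∈ S.eggs, E ⊆ A) → (∃ E ∈ S.eggs, E ⊆ Aᶜ) → k ≤ G.cutSize A}

/-- The order of a scramble. -/
noncomputable def Scramble.order {X : Type*} {G : HalfEdgeGraph X} (S : G.Scramble) : ℕ :=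
  sSup S.orderSet

/-- The scramble number: the maximal order of a scramble. -/
noncomputable def scrambleNumber {X : Type*} (G : HalfEdgeGraph X) : ℕ :=
  sSup (Set.range fun S : G.Scramble => S.order)

theorem Scramble.le_card {X : Type*} [Fintype X] [DecidableEq X] {G : HalfEdgeGraph X}
    (S : G.Scramble) {k : ℕ} (hk : k ∈ S.orderSet) : k ≤ Fintype.card G.V := by
  refine hk.1 Finset.univ fun E hE => ?_
  obtain ⟨⟨v, hv⟩⟩ := (S.connected E hE).nonempty
  exact ⟨v, Finset.mem_univ _, hv⟩

/-- The order of a scramble is an honest maximum. -/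
theorem Scramble.isGreatest_order {X : Type*} [Fintype X] [DecidableEq X] {G : HalfEdgeGraph X}
    (S : G.Scramble) : IsGreatest S.orderSet S.order := by
  have hb : BddAbove S.orderSet := ⟨_, fun _ hk => S.le_card hk⟩
  have h0 : S.orderSet.Nonempty := ⟨0, fun _ _ => Nat.zero_le _, fun _ _ _ => Nat.zero_le _⟩
  exact ⟨Nat.sSup_mem h0 hb, fun _ hk => le_csSup hb hk⟩

/-- The scramble number is an honest maximum. -/
theorem isGreatest_scrambleNumber {X : Type*} [Fintype X] [DecidableEq X] (G : HalfEdgeGraph X) :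
    IsGreatest (Set.range fun S : G.Scramble => S.order) G.scrambleNumber := by
  have hb : BddAbove (Set.range fun S : G.Scramble => S.order) := by
    refine ⟨Fintype.card G.V, ?_⟩
    rintro _ ⟨S, rfl⟩
    exact S.le_card S.isGreatest_order.1
  have h0 : (Set.range fun S : G.Scramble => S.order).Nonempty :=
    ⟨_, ⟨∅, fun _ h => h.elim⟩, rfl⟩
  exact ⟨Nat.sSup_mem h0 hb, fun _ hk => le_csSup hb hk⟩

/-! ### Treewidth -/

/-- A tree decomposition: a finite tree with a bag of vertices at every node, such that the ends of
every edge lie in a common bag, and such that for every vertex `v` the nodes whose bag contains `v`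
induce a non-empty connected subgraph (a subtree). -/
structure TreeDecomposition {X : Type*} (G : HalfEdgeGraph X) where
  Node : Type
  fintypeNode : Fintype Node
  tree : SimpleGraph Node
  isTree : tree.IsTree
  bag : Node → Finset G.V
  edge_mem : ∀ e : X, G.i e ≠ e → ∃ t, G.root e ∈ bag t ∧ G.root (G.i e) ∈ bag t
  subtree : ∀ v : G.V, (tree.induce {t | v ∈ bag t}).Connected

/-- The width: the maximal size of a bag, minus one. (For a graph with at least one vertex some bag
is non-empty, so the subtraction does not truncate.) -/
def TreeDecomposition.width {X : Type*} {G : HalfEdgeGraph X} (T : G.TreeDecomposition) : ℕ :=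
  (@Finset.univ T.Node T.fintypeNode).sup (fun t => (T.bag t).card) - 1

/-- The treewidth: the minimal width of a tree decomposition. -/
noncomputable def treewidth {X : Type*} (G : HalfEdgeGraph X) : ℕ :=
  sInf (Set.range fun T : G.TreeDecomposition => T.width)

/-- The treewidth is an honest minimum: the decomposition with a single bag always exists. -/
theorem isLeast_treewidth {X : Type*} [Fintype X] [DecidableEq X] (G : HalfEdgeGraph X) :
    IsLeast (Set.range fun T : G.TreeDecomposition => T.width) G.treewidth := by
  have h0 : (Set.range fun T : G.TreeDecomposition => T.width).Nonempty := by
    refine ⟨_, ⟨Unit, inferInstance, ⊥, SimpleGraph.IsTree.of_subsingleton,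
      fun _ => Finset.univ, fun _ _ => ⟨(), Finset.mem_univ _, Finset.mem_univ _⟩,
      fun v => ?_⟩, rfl⟩
    have : Nonempty {t : Unit | v ∈ (Finset.univ : Finset G.V)} := ⟨⟨(), Finset.mem_univ _⟩⟩
    exact SimpleGraph.IsTree.of_subsingleton.connected
  exact ⟨Nat.sInf_mem h0, fun _ hk => Nat.sInf_le hk⟩

end HalfEdgeGraph

/-! ### Monoid-metrised graphs and divisors -/

/-- A graph with a metric valued in `M`: every edge has a non-zero length in `M`. -/
structure MetrisedGraph (X : Type*) (M : Type*) [AddCancelCommMonoid M] extends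
    HalfEdgeGraph X where
  l : X → M
  l_i : ∀ x, l (i x) = l x
  l_eq_zero_iff : ∀ x, l x = 0 ↔ i x = x

namespace MetrisedGraph

/-- Divisors: the free abelian group on the finite set of vertices, as functions. -/
abbrev Divisor {X M : Type*} [AddCancelCommMonoid M] (Γ : MetrisedGraph X M) : Type _ :=
  Γ.toHalfEdgeGraph.V → ℤ

/-- The degree of a divisor. -/
def deg {X M : Type*} [Fintype X] [DecidableEq X] [AddCancelCommMonoid M] {Γ : MetrisedGraph X M}
    (D : Γ.Divisor) : ℤ := ∑ v, D v

/-- The length of (the edge containing) `e`, in the groupification of `M`. -/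
def lengthGp {X M : Type*} [AddCancelCommMonoid M] (Γ : MetrisedGraph X M) (e : X) :
    Algebra.GrothendieckAddGroup M :=
  Algebra.GrothendieckAddGroup.of (Γ.l e)

/-- `g` is piecewise linear: along every edge it changes by an integer multiple of the length. -/
def IsPL {X M : Type*} [AddCancelCommMonoid M] (Γ : MetrisedGraph X M)
    (g : Γ.toHalfEdgeGraph.V → Algebra.GrothendieckAddGroup M) : Prop :=
  ∀ e, Γ.i e ≠ e →
    g (Γ.root e) - g (Γ.root (Γ.i e)) ∈ AddSubgroup.zmultiples (Γ.lengthGp e)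

open Classical in
/-- The integer `(g (r e) - g (r (i e))) / l e`, for a piecewise linear function `g` and a
half-edge `e` (and `0` if there is no such integer); see `slope_eq`. -/
noncomputable def slope {X M : Type*} [AddCancelCommMonoid M] (Γ : MetrisedGraph X M)
    (g : Γ.toHalfEdgeGraph.V → Algebra.GrothendieckAddGroup M) (e : X) : ℤ :=
  if h : ∃ n : ℤ, n • Γ.lengthGp e = g (Γ.root e) - g (Γ.root (Γ.i e)) then h.choose else 0

/-- The Laplacian. -/
noncomputable def laplacian {X M : Type*} [Fintype X] [DecidableEq X] [AddCancelCommMonoid M]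
    (Γ : MetrisedGraph X M) (g : Γ.toHalfEdgeGraph.V → Algebra.GrothendieckAddGroup M) :
    Γ.Divisor :=
  fun v => ∑ e ∈ Γ.halfEdgesAt v, Γ.slope g e

/-- Two divisors are linearly equivalent if they differ by the Laplacian of a piecewise linear
function. -/
def LinEquiv {X M : Type*} [Fintype X] [DecidableEq X] [AddCancelCommMonoid M]
    {Γ : MetrisedGraph X M} (D D' : Γ.Divisor) : Prop :=
  ∃ g, Γ.IsPL g ∧ D - D' = Γ.laplacian g

/-- The linear system `|D|`: the effective divisors linearly equivalent to `D`. -/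
def linearSystem {X M : Type*} [Fintype X] [DecidableEq X] [AddCancelCommMonoid M]
    {Γ : MetrisedGraph X M} (D : Γ.Divisor) : Set Γ.Divisor :=
  {E | LinEquiv E D ∧ 0 ≤ E}

/-- The integers `k` such that `|D - F|` is non-empty for all effective `F` of degree `k`. -/
def rankSet {X M : Type*} [Fintype X] [DecidableEq X] [AddCancelCommMonoid M]
    {Γ : MetrisedGraph X M} (D : Γ.Divisor) : Set ℤ :=
  {k | ∀ F : Γ.Divisor, 0 ≤ F → deg F = k → (linearSystem (D - F)).Nonempty}

/-- The rank of a divisor. -/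
noncomputable def rank {X M : Type*} [Fintype X] [DecidableEq X] [AddCancelCommMonoid M]
    {Γ : MetrisedGraph X M} (D : Γ.Divisor) : ℤ := sSup (rankSet D)

/-- The divisorial gonality: the minimal degree of a divisor of positive rank. -/
noncomputable def dgon {X M : Type*} [Fintype X] [DecidableEq X] [AddCancelCommMonoid M]
    (Γ : MetrisedGraph X M) : ℤ :=
  sInf {d | ∃ D : Γ.Divisor, 1 ≤ rank D ∧ deg D = d}

/-- In the groupification of a sharp integral monoid, a non-zero element has infinite order. -/
theorem eq_zero_of_zsmul_of {M : Type*} [AddCancelCommMonoid M] [Subsingleton (AddUnits M)]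
    {m : M} (hm : m ≠ 0) {n : ℤ} (h : n • Algebra.GrothendieckAddGroup.of m = 0) : n = 0 := by
  have key : ∀ k : ℕ, k • Algebra.GrothendieckAddGroup.of m = 0 → k = 0 := by
    intro k hk
    rw [← map_nsmul, ← map_zero (Algebra.GrothendieckAddGroup.of (M := M))] at hk
    obtain ⟨c, hc⟩ := ((AddLocalization.addMonoidOf (⊤ : AddSubmonoid M)).eq_iff_exists).1 hk
    have hk0 : k • m = 0 := add_left_cancel hc
    rcases k with _ | k
    · rfl
    · rw [succ_nsmul] at hk0
      let u : AddUnits M := ⟨m, k • m, by rw [add_comm]; exact hk0, hk0⟩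
      exact absurd (congrArg AddUnits.val (Subsingleton.elim u 0)) hm
  rcases Int.eq_nat_or_neg n with ⟨k, rfl | rfl⟩
  · rw [natCast_zsmul] at h
    exact_mod_cast key k h
  · rw [neg_smul, natCast_zsmul, neg_eq_zero] at h
    simpa using key k h

/-- The slope is the unique integer that it should be. -/
theorem slope_eq {X M : Type*} [AddCancelCommMonoid M] [Subsingleton (AddUnits M)]
    (Γ : MetrisedGraph X M) (g : Γ.toHalfEdgeGraph.V → Algebra.GrothendieckAddGroup M) {e : X}
    (he : Γ.i e ≠ e) {n : ℤ}
    (hn : n • Γ.lengthGp e = g (Γ.root e) - g (Γ.root (Γ.i e))) : Γ.slope g e = n := by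
  have h : ∃ n : ℤ, n • Γ.lengthGp e = g (Γ.root e) - g (Γ.root (Γ.i e)) := ⟨n, hn⟩
  have hs : Γ.slope g e • Γ.lengthGp e = g (Γ.root e) - g (Γ.root (Γ.i e)) := by
    rw [slope, dif_pos h]; exact h.choose_spec
  have hl : Γ.l e ≠ 0 := fun h0 => he ((Γ.l_eq_zero_iff e).1 h0)
  have := eq_zero_of_zsmul_of hl (n := Γ.slope g e - n)
    (by rw [sub_smul]; exact sub_eq_zero.2 (hs.trans hn.symm))
  omega

theorem slope_i {X M : Type*} [AddCancelCommMonoid M] [Subsingleton (AddUnits M)]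
    (Γ : MetrisedGraph X M) {g : Γ.toHalfEdgeGraph.V → Algebra.GrothendieckAddGroup M}
    (hg : Γ.IsPL g) {e : X} (he : Γ.i e ≠ e) : Γ.slope g (Γ.i e) = -Γ.slope g e := by
  obtain ⟨n, hn⟩ := AddSubgroup.mem_zmultiples_iff.1 (hg e he)
  have he' : Γ.i (Γ.i e) ≠ Γ.i e := by rw [Γ.i_invol]; exact he.symm
  rw [Γ.slope_eq g he hn]
  refine Γ.slope_eq g he' ?_
  rw [Γ.i_invol, lengthGp, Γ.l_i, neg_smul]
  change -(n • Γ.lengthGp e) = _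
  rw [hn, neg_sub]

/-- Principal divisors have degree zero. -/
theorem deg_laplacian {X M : Type*} [Fintype X] [DecidableEq X] [AddCancelCommMonoid M]
    [Subsingleton (AddUnits M)] (Γ : MetrisedGraph X M)
    {g : Γ.toHalfEdgeGraph.V → Algebra.GrothendieckAddGroup M} (hg : Γ.IsPL g) :
    deg (Γ.laplacian g) = 0 := by
  have h1 : deg (Γ.laplacian g) =
      ∑ e ∈ Finset.univ.filter (fun e => Γ.i e ≠ e), Γ.slope g e := by
    rw [deg, ← Finset.sum_fiberwise_of_maps_to (t := Finset.univ) (g := Γ.root)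
      (fun _ _ => Finset.mem_univ _)]
    refine Finset.sum_congr rfl fun v _ => ?_
    rw [laplacian, HalfEdgeGraph.halfEdgesAt, Finset.filter_filter]
  have h2 : ∑ e ∈ Finset.univ.filter (fun e => Γ.i e ≠ e), Γ.slope g e =
      ∑ e ∈ Finset.univ.filter (fun e => Γ.i e ≠ e), -Γ.slope g e := by
    refine Finset.sum_bij' (fun e _ => Γ.i e) (fun e _ => Γ.i e) ?_ ?_ ?_ ?_ ?_
    · intro e he
      simp only [Finset.mem_filter, Finset.mem_univ, true_and] at he ⊢
      rw [Γ.i_invol]; exact he.symm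
    · intro e he
      simp only [Finset.mem_filter, Finset.mem_univ, true_and] at he ⊢
      rw [Γ.i_invol]; exact he.symm
    · intro e _; exact Γ.i_invol e
    · intro e _; exact Γ.i_invol e
    · intro e he
      simp only [Finset.mem_filter, Finset.mem_univ, true_and] at he
      rw [Γ.slope_i hg he, neg_neg]
  rw [Finset.sum_neg_distrib] at h2
  omega

theorem LinEquiv.deg_eq {X M : Type*} [Fintype X] [DecidableEq X] [AddCancelCommMonoid M]
    [Subsingleton (AddUnits M)] {Γ : MetrisedGraph X M} {D D' : Γ.Divisor} (h : LinEquiv D D') :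
    deg D = deg D' := by
  obtain ⟨g, hg, h⟩ := h
  have h1 := Γ.deg_laplacian hg
  rw [← h, deg] at h1
  simp only [Pi.sub_apply, Finset.sum_sub_distrib] at h1
  rw [deg, deg]
  omega

theorem LinEquiv.refl {X M : Type*} [Fintype X] [DecidableEq X] [AddCancelCommMonoid M]
    [Subsingleton (AddUnits M)] {Γ : MetrisedGraph X M} (D : Γ.Divisor) : LinEquiv D D := by
  refine ⟨fun _ => 0, fun e _ => by rw [sub_self]; exact zero_mem _, ?_⟩
  rw [sub_self]
  funext v
  refine (Finset.sum_eq_zero fun e he => ?_).symm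
  simp only [HalfEdgeGraph.halfEdgesAt, Finset.mem_filter, Finset.mem_univ, true_and] at he
  exact Γ.slope_eq _ he.1 (by simp)

theorem mem_upperBounds_rankSet {X M : Type*} [Fintype X] [DecidableEq X] [AddCancelCommMonoid M]
    [Subsingleton (AddUnits M)] {Γ : MetrisedGraph X M} (v : Γ.toHalfEdgeGraph.V)
    {D : Γ.Divisor} {k : ℤ} (hk : k ∈ rankSet D) (h0 : 0 ≤ k) : k ≤ deg D := by
  have hF : deg (Γ := Γ) (Pi.single v k) = k := by
    rw [deg, Finset.sum_pi_single']; simp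
  obtain ⟨E, hE, hE0⟩ := hk (Pi.single v k) (Pi.single_nonneg.2 h0) hF
  have h1 := hE.deg_eq
  have h2 : 0 ≤ deg E := Finset.sum_nonneg fun v _ => hE0 v
  have h3 : deg (D - Pi.single v k) = deg D - deg (Γ := Γ) (Pi.single v k) := by
    simp only [deg, Pi.sub_apply, Finset.sum_sub_distrib]
  omega

/-- The rank is an honest maximum. -/
theorem isGreatest_rank {X M : Type*} [Fintype X] [DecidableEq X] [AddCancelCommMonoid M]
    [Subsingleton (AddUnits M)] {Γ : MetrisedGraph X M} (hΓ : Γ.Connected) (D : Γ.Divisor) :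
    IsGreatest (rankSet D) (rank D) := by
  obtain ⟨v⟩ := hΓ.nonempty
  have hb : BddAbove (rankSet D) := by
    refine ⟨max (deg D) 0, fun k hk => ?_⟩
    rcases le_total 0 k with h | h
    · exact le_max_of_le_left (mem_upperBounds_rankSet v hk h)
    · exact le_max_of_le_right h
  have h0 : (rankSet D).Nonempty := by
    refine ⟨-1, fun F hF hd => ?_⟩
    have : 0 ≤ deg F := Finset.sum_nonneg fun v _ => hF v
    omega
  exact ⟨Int.csSup_mem h0 hb, fun _ hk => le_csSup hb hk⟩

/-- The divisorial gonality is an honest minimum. -/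
theorem isLeast_dgon {X M : Type*} [Fintype X] [DecidableEq X] [AddCancelCommMonoid M]
    [Subsingleton (AddUnits M)] {Γ : MetrisedGraph X M} (hΓ : Γ.Connected) :
    IsLeast {d | ∃ D : Γ.Divisor, 1 ≤ rank D ∧ deg D = d} Γ.dgon := by
  obtain ⟨v⟩ := hΓ.nonempty
  have hb : BddBelow {d | ∃ D : Γ.Divisor, 1 ≤ rank D ∧ deg D = d} := by
    refine ⟨0, ?_⟩
    rintro _ ⟨D, hD, rfl⟩
    have := mem_upperBounds_rankSet v (isGreatest_rank hΓ D).1 (by omega)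
    omega
  have h0 : {d | ∃ D : Γ.Divisor, 1 ≤ rank D ∧ deg D = d}.Nonempty := by
    refine ⟨_, fun _ => 1, (isGreatest_rank hΓ _).2 fun F hF hd => ?_, rfl⟩
    refine ⟨_, LinEquiv.refl _, fun w => ?_⟩
    have : F w ≤ deg F := Finset.single_le_sum (fun w _ => hF w) (Finset.mem_univ w)
    simp only [Pi.sub_apply, Pi.zero_apply]
    omega
  exact ⟨Int.csInf_mem h0 hb, fun _ hk => csInf_le hb hk⟩

end MetrisedGraph

/-! The bound by treewidth goes through brambles. By tree-width duality (`exists_treeDec_card_le`),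
small covers of all brambles give a tree decomposition with small bags; so if the treewidth `w` is
positive, some bramble has only covers with more than `w` vertices. Such a bramble is a scramble of
order at least `w`, because a cut with `q` edges that separates two of its members produces a cover
with at most `q + 1` vertices (`le_scrambleNumber_of_bramble`).

For the bound on gonality, the groupification of `M` receives a total preorder in which all lengths
are strictly positive (`exists_total_cone`). The graph then behaves like a tropical curve: the
maximum of two potentials of effective divisors equivalent to `D` is again one, provided that chips
may lie in the interiors of edges (`Chips`). The total number of chips is always `deg D`. An edge
along which the larger of two potentials changes carries a chip of the maximum, so the set where one
dominates the other has at most `deg D` boundary edges (`cutSize_le_deg`).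

Suppose now that a scramble has order greater than `deg D`. Such sets cannot separate eggs, and
after a suitable shift the maximum of `s` and `t` hits every egg hit by `s`, as well as every egg
containing a vertex with a chip of `t` (`exists_join`). If `D` has positive rank, a chip can be put
on any vertex, so a configuration that hits a maximal set of eggs hits all of them. Its at most `deg
D` chips give a hitting set that is too small (`exists_cover`). -/

/-! ### Connected sets and trees -/

namespace SimpleGraph

/-- A set `S` of vertices is non-empty, and no subset of it is separated from the rest of `S`. -/
def ConnOn {V : Type*} (H : SimpleGraph V) (S : Set V) : Prop :=
  S.Nonempty ∧ ∀ U : Set V, (∃ a ∈ S, a ∈ U) → (∃ b ∈ S, b ∉ U) →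
    ∃ u ∈ S, ∃ w ∈ S, u ∈ U ∧ w ∉ U ∧ H.Adj u w

theorem connOn_iff {V : Type*} {H : SimpleGraph V} {S : Set V} :
    H.ConnOn S ↔ (H.induce S).Connected := by
  constructor
  · rintro ⟨⟨x, hx⟩, h⟩
    have : Nonempty S := ⟨⟨x, hx⟩⟩
    refine ⟨fun a b => ?_⟩
    by_contra hab
    obtain ⟨u, hu, w, hw, ⟨hu', hr⟩, hw', huw⟩ :=
      h {v | ∃ hv : v ∈ S, (H.induce S).Reachable a ⟨v, hv⟩} ⟨a, a.2, a.2, .rfl⟩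
        ⟨b, b.2, fun ⟨_, hr⟩ => hab hr⟩
    refine hw' ⟨hw, hr.trans (Adj.reachable ?_)⟩
    exact huw
  · intro h
    obtain ⟨x⟩ := h.nonempty
    refine ⟨⟨x, x.2⟩, ?_⟩
    rintro U ⟨a, ha, haU⟩ ⟨b, hb, hbU⟩
    obtain ⟨p⟩ := h.preconnected ⟨a, ha⟩ ⟨b, hb⟩
    obtain ⟨d, -, h1, h2⟩ := p.exists_boundary_dart (Subtype.val ⁻¹' U) haU hbU
    exact ⟨_, d.fst.2, _, d.snd.2, h1, h2, d.adj⟩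

namespace ConnOn

variable {V W : Type*} {H : SimpleGraph V} {K : SimpleGraph W} {S T : Set V}

theorem image (f : V → W) (hf : ∀ u v, H.Adj u v → K.Adj (f u) (f v)) (h : H.ConnOn S) :
    K.ConnOn (f '' S) := by
  refine ⟨h.1.image f, ?_⟩
  rintro U ⟨_, ⟨a, ha, rfl⟩, haU⟩ ⟨_, ⟨b, hb, rfl⟩, hbU⟩
  obtain ⟨u, hu, w, hw, h1, h2, h3⟩ := h.2 (f ⁻¹' U) ⟨a, ha, haU⟩ ⟨b, hb, hbU⟩
  exact ⟨_, ⟨u, hu, rfl⟩, _, ⟨w, hw, rfl⟩, h1, h2, hf _ _ h3⟩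

theorem union_of_adj (hS : H.ConnOn S) (hT : H.ConnOn T) {s t : V} (hs : s ∈ S) (ht : t ∈ T)
    (hst : H.Adj s t) : H.ConnOn (S ∪ T) := by
  refine ⟨⟨s, Or.inl hs⟩, fun U hU hU' => ?_⟩
  by_cases hcS : (∃ a ∈ S, a ∈ U) ∧ ∃ b ∈ S, b ∉ U
  · obtain ⟨u, hu, w, hw, h⟩ := hS.2 U hcS.1 hcS.2
    exact ⟨u, Or.inl hu, w, Or.inl hw, h⟩
  by_cases hcT : (∃ a ∈ T, a ∈ U) ∧ ∃ b ∈ T, b ∉ U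
  · obtain ⟨u, hu, w, hw, h⟩ := hT.2 U hcT.1 hcT.2
    exact ⟨u, Or.inr hu, w, Or.inr hw, h⟩
  obtain ⟨a, ha, haU⟩ := hU
  obtain ⟨b, hb, hbU⟩ := hU'
  have := hst.symm
  by_cases h1 : s ∈ U <;> by_cases h2 : t ∈ U
  · rcases hb with hb | hb
    · exact absurd ⟨⟨s, hs, h1⟩, b, hb, hbU⟩ hcS
    · exact absurd ⟨⟨t, ht, h2⟩, b, hb, hbU⟩ hcT
  · exact ⟨s, Or.inl hs, t, Or.inr ht, h1, h2, hst⟩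
  · exact ⟨t, Or.inr ht, s, Or.inl hs, h2, h1, this⟩
  · rcases ha with ha | ha
    · exact absurd ⟨⟨a, ha, haU⟩, s, hs, h1⟩ hcS
    · exact absurd ⟨⟨a, ha, haU⟩, t, ht, h2⟩ hcT

theorem union_of_mem (hS : H.ConnOn S) (hT : H.ConnOn T) {s : V} (hs : s ∈ S) (ht : s ∈ T) :
    H.ConnOn (S ∪ T) := by
  rw [connOn_iff] at *
  exact induce_union_connected hS.preconnected hT.preconnected ⟨s, hs, ht⟩

end ConnOn

theorem connOn_singleton {V : Type*} (H : SimpleGraph V) (v : V) : H.ConnOn {v} := by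
  refine ⟨⟨v, rfl⟩, ?_⟩
  rintro U ⟨a, rfl, ha⟩ ⟨b, rfl, hb⟩
  exact absurd ha hb

/-- In a forest, the vertices on the path between two vertices form the smallest connected set
containing both. -/
theorem IsTree.exists_least_connOn {V : Type*} {T : SimpleGraph V} (hT : T.IsTree) (s t : V) :
    ∃ P : Set V, s ∈ P ∧ t ∈ P ∧ T.ConnOn P ∧
      ∀ S : Set V, T.ConnOn S → s ∈ S → t ∈ S → P ⊆ S := by
  classical
  obtain ⟨p⟩ := hT.connected.preconnected s t
  refine ⟨{v | v ∈ p.toPath.1.support}, p.toPath.1.start_mem_support,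
    p.toPath.1.end_mem_support, connOn_iff.2 (Walk.connected_induce_support _), ?_⟩
  intro S hS hs ht v hv
  obtain ⟨q⟩ := (connOn_iff.1 hS).preconnected ⟨s, hs⟩ ⟨t, ht⟩
  let q' : T.Walk s t := q.map (Embedding.induce S).toHom
  have hq : ∀ x ∈ q'.support, x ∈ S := by
    intro x hx
    have hx' : x ∈ (q.map (Embedding.induce S).toHom).support := hx
    rw [Walk.support_map, List.mem_map] at hx'
    obtain ⟨y, -, rfl⟩ := hx'
    exact y.2
  rw [Set.mem_ofPred_eq, (hT.isAcyclic.subsingleton_path s t).elim p.toPath q'.toPath] at hv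
  exact hq v (Walk.support_toPath_subset_support _ hv)

/-- A walk in `K` that starts in the image of `f` never leaves it, so a walk around the image of the
edge would pull back to a walk around the edge in `G`. -/
theorem IsBridge.map_of_closed {V W : Type*} {G : SimpleGraph V} {K : SimpleGraph W} (f : V → W)
    (hf : Function.Injective f) (hK : ∀ a y, K.Adj (f a) y → ∃ b, y = f b ∧ G.Adj a b) {v w : V}
    (h : G.IsBridge s(v, w)) : K.IsBridge s(f v, f w) := by
  rw [isBridge_iff] at h ⊢
  rintro ⟨p⟩
  obtain ⟨d, -, ⟨y, hy, hr⟩, h2⟩ := p.exists_boundary_dart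
    {x | ∃ y, x = f y ∧ (G.deleteEdges {s(v, w)}).Reachable v y} ⟨v, rfl, .rfl⟩
    (fun ⟨y, hy, hr⟩ => h (hf hy ▸ hr))
  have hd := d.adj
  rw [deleteEdges_adj, hy] at hd
  obtain ⟨b, hb, hab⟩ := hK _ _ hd.1
  refine h2 ⟨b, hb, hr.trans (Adj.reachable ?_)⟩
  rw [deleteEdges_adj]
  refine ⟨hab, fun he => hd.2 ?_⟩
  rw [Set.mem_singleton_iff] at he ⊢
  rw [hb, ← Sym2.map_mk, ← Sym2.map_mk, he]

theorem IsAcyclic.sum {V W : Type*} {G : SimpleGraph V} {H : SimpleGraph W} (hG : G.IsAcyclic)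
    (hH : H.IsAcyclic) : (G ⊕g H).IsAcyclic := by
  rw [isAcyclic_iff_forall_adj_isBridge] at *
  rintro (v | v) (w | w) hvw
  · refine (hG (by simpa using hvw)).map_of_closed Sum.inl Sum.inl_injective ?_
    rintro a (y | y) h
    · exact ⟨y, rfl, by simpa using h⟩
    · simp at h
  · simp at hvw
  · simp at hvw
  · refine (hH (by simpa using hvw)).map_of_closed Sum.inr Sum.inr_injective ?_
    rintro a (y | y) h
    · simp at h
    · exact ⟨y, rfl, by simpa using h⟩

/-- Two trees joined by an edge form a tree. -/
theorem IsTree.sum_sup_edge {V W : Type*} {G : SimpleGraph V} {H : SimpleGraph W} (hG : G.IsTree)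
    (hH : H.IsTree) (v : V) (w : W) : ((G ⊕g H) ⊔ edge (.inl v) (.inr w)).IsTree :=
  ⟨hG.connected.sum_sup_edge hH.connected,
    (hG.isAcyclic.sum hH.isAcyclic).sup_edge_of_not_reachable (not_reachable_sum_inl_inr v w)⟩

end SimpleGraph

/-! ### Brambles and tree decompositions -/

namespace SimpleGraph

variable {V : Type*}

/-- Two sets of vertices touch if they intersect or are joined by an edge. -/
def Touches (H : SimpleGraph V) (E F : Set V) : Prop :=
  ∃ u ∈ E, ∃ v ∈ F, u = v ∨ H.Adj u v

/-- A bramble is a set of pairwise touching connected sets. -/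
def IsBramble (H : SimpleGraph V) (B : Set (Set V)) : Prop :=
  (∀ E ∈ B, H.ConnOn E) ∧ ∀ E ∈ B, ∀ F ∈ B, H.Touches E F

/-- `X` meets every member of `B`. -/
def Covers (X : Finset V) (B : Set (Set V)) : Prop := ∀ E ∈ B, ∃ v ∈ X, v ∈ E

/-- A tree decomposition of the subgraph induced on `S`. -/
structure TreeDec (H : SimpleGraph V) (S : Finset V) where
  Node : Type
  fintypeNode : Fintype Node
  tree : SimpleGraph Node
  isTree : tree.IsTree
  bag : Node → Finset V
  bag_subset : ∀ t, bag t ⊆ S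
  exists_bag : ∀ u ∈ S, ∀ v ∈ S, H.Adj u v → ∃ t, u ∈ bag t ∧ v ∈ bag t
  subtree : ∀ v ∈ S, tree.ConnOn {t | v ∈ bag t}

/-- The maximal connected set of vertices avoiding `X` around a vertex. -/
theorem exists_component [Finite V] (H : SimpleGraph V) (X : Set V) {v : V} (hv : v ∉ X) :
    ∃ C : Set V, H.ConnOn C ∧ v ∈ C ∧ (∀ c ∈ C, c ∉ X) ∧
      ∀ c ∈ C, ∀ u, H.Adj c u → u ∉ X → u ∈ C := by
  obtain ⟨C, ⟨hC, hvC, hX⟩, hmax⟩ :=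
    (Set.toFinite {C : Set V | H.ConnOn C ∧ v ∈ C ∧ ∀ c ∈ C, c ∉ X}).exists_maximal
      ⟨{v}, H.connOn_singleton v, rfl, by rintro c rfl; exact hv⟩
  refine ⟨C, hC, hvC, hX, fun c hc u hcu hu => ?_⟩
  refine hmax (y := C ∪ {u}) ⟨hC.union_of_adj (H.connOn_singleton u) hc rfl hcu, Or.inl hvC, ?_⟩
    Set.subset_union_left (Or.inr rfl)
  rintro x (hx | rfl)
  · exact hX x hx
  · exact hu

namespace TreeDec

variable {H : SimpleGraph V}

/-- The nodes whose bags meet a connected set form a connected set. -/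
theorem connOn_nodes {S : Finset V} (D : TreeDec H S) {E : Set V} (hE : H.ConnOn E)
    (hES : ∀ v ∈ E, v ∈ S) : D.tree.ConnOn {t | ∃ v ∈ E, v ∈ D.bag t} := by
  obtain ⟨⟨x, hx⟩, hE⟩ := hE
  obtain ⟨t, ht⟩ := (D.subtree x (hES x hx)).1
  refine ⟨⟨t, x, hx, ht⟩, ?_⟩
  rintro U ⟨t₁, ⟨v₁, hv₁, ht₁⟩, hU₁⟩ ⟨t₂, ⟨v₂, hv₂, ht₂⟩, hU₂⟩
  by_contra hcon
  -- If no tree edge between these nodes crosses `U`, the subtree of each vertex of `E` lies on one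
  -- side of `U`. Connectedness of `E` then gives an edge with ends on different sides, which
  -- contradicts the bag containing both ends.
  have key : ∀ v ∈ E, ∀ a b, v ∈ D.bag a → v ∈ D.bag b → a ∈ U → b ∈ U := by
    intro v hv a b ha hb haU
    by_contra hbU
    obtain ⟨u, hu, w, hw, h⟩ := (D.subtree v (hES v hv)).2 U ⟨a, ha, haU⟩ ⟨b, hb, hbU⟩
    exact hcon ⟨u, ⟨v, hv, hu⟩, w, ⟨v, hv, hw⟩, h⟩
  obtain ⟨u, hu, w, hw, hu', hw', huw⟩ := hE {v | ∃ t, v ∈ D.bag t ∧ t ∈ U}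
    ⟨v₁, hv₁, t₁, ht₁, hU₁⟩ ⟨v₂, hv₂, fun ⟨t, ht, htU⟩ => hU₂ (key v₂ hv₂ _ _ ht ht₂ htU)⟩
  obtain ⟨t, htu, htw⟩ := D.exists_bag u (hES u hu) w (hES w hw) huw
  obtain ⟨t', ht', htU'⟩ := hu'
  exact hw' ⟨t, htw, key u hu _ _ ht' htu htU'⟩

/-- The decomposition with a single bag. -/
def single (H : SimpleGraph V) (S : Finset V) : TreeDec H S where
  Node := Unit
  fintypeNode := inferInstance
  tree := ⊥
  isTree := IsTree.of_subsingleton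
  bag _ := S
  bag_subset _ := subset_rfl
  exists_bag u hu v hv _ := ⟨(), hu, hv⟩
  subtree v hv := by
    have : {t : Unit | v ∈ S} = {()} := by ext; simp [hv]
    rw [this]
    exact connOn_singleton _ _

variable [DecidableEq V]

/-- Two tree decompositions can be joined by an edge between two bags that contain the common
vertices. -/
def glue {S₁ S₂ : Finset V} (D₁ : TreeDec H S₁) (D₂ : TreeDec H S₂) (s₁ : D₁.Node) (s₂ : D₂.Node)
    (h₁ : ∀ v ∈ S₁, v ∈ S₂ → v ∈ D₁.bag s₁ ∧ v ∈ D₂.bag s₂)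
    (h₂ : ∀ u ∈ S₁, ∀ v ∈ S₂, H.Adj u v → u ∈ S₂ ∨ v ∈ S₁) : TreeDec H (S₁ ∪ S₂) where
  Node := D₁.Node ⊕ D₂.Node
  fintypeNode := @instFintypeSum _ _ D₁.fintypeNode D₂.fintypeNode
  tree := (D₁.tree ⊕g D₂.tree) ⊔ edge (.inl s₁) (.inr s₂)
  isTree := D₁.isTree.sum_sup_edge D₂.isTree s₁ s₂
  bag := Sum.elim D₁.bag D₂.bag
  bag_subset := by
    rintro (t | t)
    · exact (D₁.bag_subset t).trans Finset.subset_union_left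
    · exact (D₂.bag_subset t).trans Finset.subset_union_right
  exists_bag := by
    have l : ∀ u ∈ S₁, ∀ v ∈ S₁, H.Adj u v →
        ∃ t, u ∈ Sum.elim D₁.bag D₂.bag t ∧ v ∈ Sum.elim D₁.bag D₂.bag t := fun u hu v hv h => by
      obtain ⟨t, ht⟩ := D₁.exists_bag u hu v hv h
      exact ⟨.inl t, ht⟩
    have r : ∀ u ∈ S₂, ∀ v ∈ S₂, H.Adj u v →
        ∃ t, u ∈ Sum.elim D₁.bag D₂.bag t ∧ v ∈ Sum.elim D₁.bag D₂.bag t := fun u hu v hv h => by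
      obtain ⟨t, ht⟩ := D₂.exists_bag u hu v hv h
      exact ⟨.inr t, ht⟩
    intro u hu v hv h
    rcases Finset.mem_union.1 hu with hu | hu <;> rcases Finset.mem_union.1 hv with hv | hv
    · exact l u hu v hv h
    · rcases h₂ u hu v hv h with h' | h'
      · exact r u h' v hv h
      · exact l u hu v h' h
    · rcases h₂ v hv u hu h.symm with h' | h'
      · exact r u hu v h' h
      · exact l u h' v hv h
    · exact r u hu v hv h
  subtree := by
    intro v hv
    have hu : {t | v ∈ Sum.elim D₁.bag D₂.bag t} =
        Sum.inl '' {t | v ∈ D₁.bag t} ∪ Sum.inr '' {t | v ∈ D₂.bag t} := by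
      ext (t | t) <;> simp
    have hl : v ∈ S₁ → ((D₁.tree ⊕g D₂.tree) ⊔ edge (.inl s₁) (.inr s₂)).ConnOn
        (Sum.inl '' {t | v ∈ D₁.bag t}) := fun h =>
      (D₁.subtree v h).image _ fun a b hab => Or.inl (by simpa using hab)
    have hr : v ∈ S₂ → ((D₁.tree ⊕g D₂.tree) ⊔ edge (.inl s₁) (.inr s₂)).ConnOn
        (Sum.inr '' {t | v ∈ D₂.bag t}) := fun h =>
      (D₂.subtree v h).image _ fun a b hab => Or.inl (by simpa using hab)
    rw [hu]
    by_cases h1 : v ∈ S₁ <;> by_cases h2 : v ∈ S₂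
    · exact (hl h1).union_of_adj (hr h2) ⟨s₁, (h₁ v h1 h2).1, rfl⟩ ⟨s₂, (h₁ v h1 h2).2, rfl⟩
        (Or.inr (by simp [edge_adj]))
    · have : {t | v ∈ D₂.bag t} = ∅ :=
        Set.eq_empty_of_forall_notMem fun t ht => h2 (D₂.bag_subset t ht)
      rw [this, Set.image_empty, Set.union_empty]
      exact hl h1
    · have : {t | v ∈ D₁.bag t} = ∅ :=
        Set.eq_empty_of_forall_notMem fun t ht => h1 (D₁.bag_subset t ht)
      rw [this, Set.image_empty, Set.empty_union]
      exact hr h2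
    · exact absurd (Finset.mem_union.1 hv) (by tauto)

variable [Fintype V]

open Classical in
/-- Restrict a decomposition of the whole graph to `X ∪ C`, and extend the subtree of every
`x ∈ X` by a set `P x` of nodes. -/
noncomputable def restrict (D : TreeDec H Finset.univ) (X C : Finset V)
    (P : V → Set D.Node) (hP : ∀ x, D.tree.ConnOn (P x))
    (hPx : ∀ x, ∃ t ∈ P x, x ∈ D.bag t) : TreeDec H (X ∪ C) where
  Node := D.Node
  fintypeNode := D.fintypeNode
  tree := D.tree
  isTree := D.isTree
  bag t := D.bag t ∩ (X ∪ C) ∪ X.filter fun x => t ∈ P x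
  bag_subset t := Finset.union_subset Finset.inter_subset_right
    ((Finset.filter_subset _ _).trans Finset.subset_union_left)
  exists_bag u hu v hv h := by
    obtain ⟨t, htu, htv⟩ := D.exists_bag u (Finset.mem_univ _) v (Finset.mem_univ _) h
    exact ⟨t, Finset.mem_union_left _ (Finset.mem_inter.2 ⟨htu, hu⟩),
      Finset.mem_union_left _ (Finset.mem_inter.2 ⟨htv, hv⟩)⟩
  subtree v hv := by
    by_cases hX : v ∈ X
    · obtain ⟨t, htP, ht⟩ := hPx v
      convert (D.subtree v (Finset.mem_univ _)).union_of_mem (hP v) ht htP using 1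
      ext t
      simp [hX]
    · convert D.subtree v (Finset.mem_univ _) using 1
      ext t
      simpa [hX] using fun _ => (Finset.mem_union.1 hv).resolve_left hX

end TreeDec

/-- A bag is admissible if it has at most `k` elements or does not cover `B`. -/
def Admissible (k : ℕ) (B : Set (Set V)) (X : Finset V) : Prop := X.card ≤ k ∨ ¬ Covers X B

/-! ### Tree-width duality -/

section

variable [Fintype V] [DecidableEq V] {H : SimpleGraph V}

/-- The main step in the proof of tree-width duality: if `D` is admissible for the bramble with the
component `C` of the complement of a minimal cover `X` added, and has a large bag that covers the
bramble, then the part on `X ∪ C` can be decomposed with `X` as a bag. -/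
theorem exists_treeDec_of_bag_covers {k : ℕ} {B : Set (Set V)} (hB : H.IsBramble B) {X : Finset V}
    (hXk : X.card ≤ k) (hmin : ∀ Y : Finset V, Covers Y B → X.card ≤ Y.card)
    (hXc : Covers X B) {C : Finset V}
    (hCcl : ∀ c ∈ C, ∀ u, H.Adj c u → u ∉ X → u ∈ C) (D : TreeDec H Finset.univ)
    (hD : ∀ t, Admissible k (insert (C : Set V) B) (D.bag t)) (s : D.Node)
    (hs : k < (D.bag s).card) (hsB : Covers (D.bag s) B) :
    ∃ D' : TreeDec H (X ∪ C), (∀ t, Admissible k B (D'.bag t)) ∧ ∃ s, D'.bag s = X := by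
  classical
  -- The bag at `s` is large, so it misses a member of the enlarged bramble; as it covers `B`, that
  -- member is `C`.
  have hsC : ∀ c ∈ C, c ∉ D.bag s := by
    rcases hD s with h | h
    · omega
    · intro c hc hcs
      refine h fun E hE => ?_
      rcases hE with rfl | hE
      · exact ⟨c, hcs, hc⟩
      · exact hsB E hE
  choose n hn using fun v => (D.subtree v (Finset.mem_univ v)).1
  choose P hnP hsP hP hPmin using fun v => D.isTree.exists_least_connOn (n v) s
  -- a connected set containing `x` and a vertex in the bag at `s` meets the bags along `P x`
  have meet : ∀ E : Set V, H.ConnOn E → ∀ x ∈ E, ∀ y ∈ E, y ∈ D.bag s → ∀ t ∈ P x,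
      ∃ z ∈ E, z ∈ D.bag t := fun E hE x hx y hy hys t ht =>
    hPmin x _ (D.connOn_nodes hE fun _ _ => Finset.mem_univ _) ⟨x, hx, hn x⟩ ⟨y, hy, hys⟩ ht
  let D' := D.restrict X C P hP fun x => ⟨n x, hnP x, hn x⟩
  refine ⟨D', fun t => ?_, s, ?_⟩
  · change Admissible k B (D.bag t ∩ (X ∪ C) ∪ X.filter fun x => t ∈ P x)
    -- The vertices that the bag at `t` gains because their paths to `s` pass through `t`.
    set Xt := X.filter fun x => t ∈ P x ∧ x ∉ D.bag t with hXt
    have hW : (D.bag t ∩ (X ∪ C) ∪ X.filter fun x => t ∈ P x) = D.bag t ∩ (X ∪ C) ∪ Xt := by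
      ext z
      simp only [hXt, Finset.mem_union, Finset.mem_inter, Finset.mem_filter]
      tauto
    -- Once this set is known to cover `B`, minimality of `X` shows that the bag at `t` loses at
    -- least as many vertices as it gains.
    have hZ : Covers (X \ Xt ∪ D.bag t \ (X ∪ C)) B := by
      intro E hE
      by_contra hcon
      have h1 : ∀ x ∈ E, x ∈ X → x ∈ Xt := fun x hxE hx => by
        by_contra hxt
        exact hcon ⟨x, Finset.mem_union_left _ (Finset.mem_sdiff.2 ⟨hx, hxt⟩), hxE⟩
      have h2 : ∀ x ∈ E, x ∈ D.bag t → x ∈ X ∪ C := fun x hxE hx => by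
        by_contra hxt
        exact hcon ⟨x, Finset.mem_union_right _ (Finset.mem_sdiff.2 ⟨hx, hxt⟩), hxE⟩
      obtain ⟨x, hxX, hxE⟩ := hXc E hE
      obtain ⟨y, hys, hyE⟩ := hsB E hE
      have hyX : y ∉ X := fun hyX => by
        have hy := (Finset.mem_filter.1 (h1 y hyE hyX)).2
        obtain ⟨z, rfl, hz⟩ := meet {y} (H.connOn_singleton y) y rfl y rfl hys t hy.1
        exact hy.2 hz
      -- `K` is the component of `y` in `E` minus `X`; it avoids `C` because `y` does. Since `E` is
      -- connected, `K` has a neighbour `w` in `E ∩ X`, and the path of `w` to `s` forces `K ∪ {w}`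
      -- to meet the bag at `t`, which is impossible.
      obtain ⟨K, hK, hyK, hKX, hKcl⟩ := H.exists_component (v := y) ((X : Set V) ∪ Eᶜ)
        (by simp [hyX, hyE])
      have hKE : ∀ z ∈ K, z ∈ E := fun z hz => by
        by_contra h
        exact hKX z hz (Or.inr h)
      have hKX' : ∀ z ∈ K, z ∉ X := fun z hz h => hKX z hz (Or.inl h)
      have hKC : ∀ z ∈ K, z ∉ C := by
        intro z hz hzC
        obtain ⟨u, hu, w, hw, huC, hwC, huw⟩ := hK.2 C ⟨z, hz, hzC⟩
          ⟨y, hyK, fun h => hsC y h hys⟩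
        exact hwC (hCcl u huC w huw (hKX' w hw))
      obtain ⟨u, hu, w, hw, huK, hwK, huw⟩ := (hB.1 E hE).2 K ⟨y, hyE, hyK⟩
        ⟨x, hxE, fun h => hKX' x h hxX⟩
      have hwX : w ∈ X := by
        by_contra h
        exact hwK (hKcl u huK w huw (by simp [h, hw]))
      have hwt := (Finset.mem_filter.1 (h1 w hw hwX)).2
      obtain ⟨z, hz, hzt⟩ := meet (K ∪ {w}) (hK.union_of_adj (H.connOn_singleton w) huK rfl huw) w
        (Or.inr rfl) y (Or.inl hyK) hys t hwt.1
      rcases hz with hz | rfl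
      · rcases Finset.mem_union.1 (h2 z (hKE z hz) hzt) with h | h
        · exact hKX' z hz h
        · exact hKC z hz h
      · exact hwt.2 hzt
    rw [hW]
    by_cases hk : (D.bag t ∩ (X ∪ C) ∪ Xt).card ≤ k
    · exact Or.inl hk
    refine Or.inr fun hcov => ?_
    have hle : (D.bag t ∩ (X ∪ C) ∪ Xt).card ≤ (D.bag t).card := by
      have c1 := (hmin _ hZ).trans (Finset.card_union_le _ _)
      have c2 : (X \ Xt).card + Xt.card = X.card :=
        Finset.card_sdiff_add_card_eq_card (Finset.filter_subset _ X)
      have c3 := Finset.card_inter_add_card_sdiff (D.bag t) (X ∪ C)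
      have c4 := Finset.card_union_le (D.bag t ∩ (X ∪ C)) Xt
      omega
    rcases hD t with h | h
    · omega
    · refine h fun E hE => ?_
      rcases hE with rfl | hE
      -- If the old bag missed `C`, the new one would lie inside `X`, hence be small.
      · by_contra hno
        refine hk ((Finset.card_le_card fun z hz => ?_).trans hXk)
        rcases Finset.mem_union.1 hz with hz | hz
        · rcases Finset.mem_union.1 (Finset.mem_inter.1 hz).2 with h' | h'
          · exact h'
          · exact absurd ⟨z, (Finset.mem_inter.1 hz).1, h'⟩ hno
        · exact (Finset.mem_filter.1 hz).1
      · obtain ⟨z, hz, hzE⟩ := hcov E hE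
        rcases Finset.mem_union.1 hz with hz | hz
        · exact ⟨z, (Finset.mem_inter.1 hz).1, hzE⟩
        · obtain ⟨y, hys, hyE⟩ := hsB E hE
          obtain ⟨w, hw, hwt⟩ := meet E (hB.1 E hE) z hzE y hyE hys t (Finset.mem_filter.1 hz).2.1
          exact ⟨w, hwt, hw⟩
  · change (D.bag s ∩ (X ∪ C) ∪ X.filter fun x => s ∈ P x) = X
    ext z
    have := hsC z
    have := hsP z
    simp only [Finset.mem_union, Finset.mem_inter, Finset.mem_filter]
    tauto

/-- If every bramble has a cover of size at most `k`, then for every bramble there is a tree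
decomposition whose bags of size greater than `k` do not cover it. -/
theorem exists_admissible_treeDec {k : ℕ}
    (hk : ∀ B, H.IsBramble B → ∃ X : Finset V, X.card ≤ k ∧ Covers X B) (B : Set (Set V)) :
    H.IsBramble B → ∃ D : TreeDec H Finset.univ, ∀ t, Admissible k B (D.bag t) := by
  classical
  -- Induction from larger brambles to smaller ones; there are only finitely many sets of vertex
  -- sets.
  induction B using WellFoundedGT.induction with
  | ind B ih =>
  intro hB
  obtain ⟨X, hXc, hmin⟩ : ∃ X : Finset V, Covers X B ∧
      ∀ Y : Finset V, Covers Y B → X.card ≤ Y.card := by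
    obtain ⟨X₀, -, h₀⟩ := hk B hB
    obtain ⟨X, hX, hX'⟩ := (Set.toFinite {X : Finset V | Covers X B}).exists_minimalFor
      Finset.card _ ⟨X₀, h₀⟩
    exact ⟨X, hX, fun Y hY => (le_total _ _).elim id fun h => hX' hY h⟩
  have hXk : X.card ≤ k := by
    obtain ⟨Y, hY, hY'⟩ := hk B hB
    exact (hmin Y hY').trans hY
  by_contra hno
  have comp : ∀ v ∉ X, ∃ C : Finset V, H.ConnOn C ∧ v ∈ C ∧ (∀ c ∈ C, c ∉ X) ∧
      (∀ c ∈ C, ∀ u, H.Adj c u → u ∉ X → u ∈ C) ∧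
      ∃ D : TreeDec H (X ∪ C), (∀ t, Admissible k B (D.bag t)) ∧ ∃ s, D.bag s = X := by
    intro v hv
    obtain ⟨C', hC, hvC, hCX, hCcl⟩ := H.exists_component (X : Set V) (v := v) (by simpa using hv)
    obtain ⟨C, rfl⟩ : ∃ C : Finset V, (C : Set V) = C' := ⟨C'.toFinset, by simp⟩
    refine ⟨C, hC, hvC, hCX, hCcl, ?_⟩
    by_cases hB' : H.IsBramble (insert (C : Set V) B)
    · have hlt : B < insert (C : Set V) B := by
        refine lt_of_le_of_ne (Set.subset_insert _ _) fun h => ?_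
        obtain ⟨x, hx, hxC⟩ := hXc C (h ▸ Set.mem_insert _ _)
        exact hCX x hxC hx
      obtain ⟨D, hD⟩ := ih _ hlt hB'
      obtain ⟨s, hs⟩ := not_forall.1 fun h => hno ⟨D, h⟩
      rw [Admissible, not_or, not_not] at hs
      exact exists_treeDec_of_bag_covers hB hXk hmin hXc hCcl D hD s (by omega) hs.2
    · obtain ⟨E, hE, hEC⟩ : ∃ E ∈ B, ¬ H.Touches C E := by
        by_contra hcon
        push Not at hcon
        refine hB' ⟨?_, ?_⟩
        · rintro E (rfl | hE)
          · exact hC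
          · exact hB.1 E hE
        · rintro E (rfl | hE) F (rfl | hF)
          · exact ⟨v, hvC, v, hvC, Or.inl rfl⟩
          · exact hcon F hF
          · obtain ⟨u, hu, w, hw, h⟩ := hcon E hE
            exact ⟨w, hw, u, hu, h.imp Eq.symm Adj.symm⟩
          · exact hB.2 E hE F hF
      -- No edge joins `C` to `X ∩ E`, so the two bags `X` and `Y` suffice. `Y` may be large, but it
      -- misses `E`.
      let Y : Finset V := C ∪ X.filter fun x => x ∉ E
      have hY : X ∪ Y = X ∪ C := by
        ext z
        simp only [Y, Finset.mem_union, Finset.mem_filter]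
        tauto
      rw [← hY]
      refine ⟨(TreeDec.single H X).glue (TreeDec.single H Y) () () (fun v h1 h2 => ⟨h1, h2⟩) ?_,
        ?_, .inl (), rfl⟩
      · intro u hu w hw huw
        rcases Finset.mem_union.1 hw with hw | hw
        · refine Or.inl (Finset.mem_union_right _ (Finset.mem_filter.2 ⟨hu, fun huE => hEC ?_⟩))
          exact ⟨w, hw, u, huE, Or.inr huw.symm⟩
        · exact Or.inr (Finset.mem_filter.1 hw).1
      · rintro (t | t)
        · exact Or.inl hXk
        · refine Or.inr fun hcov => ?_
          obtain ⟨z, hz, hzE⟩ := hcov E hE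
          rcases Finset.mem_union.1 hz with hz | hz
          · exact hEC ⟨z, hz, z, hzE, Or.inl rfl⟩
          · exact (Finset.mem_filter.1 hz).2 hzE
  -- a maximal union of components that can be decomposed with `X` as a bag
  obtain ⟨S, ⟨hXS, hcl, D, hD, s, hs⟩, hmax⟩ :=
    (Set.toFinite {S : Finset V | X ⊆ S ∧ (∀ u ∈ S, u ∉ X → ∀ v, H.Adj u v → v ∈ S) ∧
      ∃ D : TreeDec H S, (∀ t, Admissible k B (D.bag t)) ∧ ∃ s, D.bag s = X}).exists_maximal
      ⟨X, subset_rfl, fun u h h' => absurd h h', TreeDec.single H X, fun _ => Or.inl hXk, (), rfl⟩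
  by_cases hS : S = Finset.univ
  · subst hS
    exact hno ⟨D, hD⟩
  obtain ⟨v, hv⟩ : ∃ v, v ∉ S := by
    by_contra! h
    exact hS (Finset.eq_univ_of_forall h)
  obtain ⟨C, hC, hvC, hCX, hCcl, D', hD', s', hs'⟩ := comp v fun h => hv (hXS h)
  have hCS : ∀ c ∈ C, c ∉ S := by
    intro c hc hcS
    obtain ⟨u, hu, w, hw, huS, hwS, huw⟩ := hC.2 S ⟨c, hc, hcS⟩ ⟨v, hvC, hv⟩
    exact hwS (hcl u huS (hCX u hu) w huw)
  refine hv (hmax (y := S ∪ (X ∪ C)) ⟨hXS.trans Finset.subset_union_left, ?_,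
    D.glue D' s s' ?_ ?_, ?_, .inl s, hs⟩ Finset.subset_union_left
    (Finset.mem_union_right _ (Finset.mem_union_right _ hvC)))
  · intro u hu huX w huw
    by_cases huS : u ∈ S
    · exact Finset.mem_union_left _ (hcl u huS huX w huw)
    · have huC : u ∈ C := by
        simp only [Finset.mem_union] at hu
        tauto
      by_cases hwX : w ∈ X
      · exact Finset.mem_union_left _ (hXS hwX)
      · exact Finset.mem_union_right _ (Finset.mem_union_right _ (hCcl u huC w huw hwX))
  · intro w hwS hw
    rw [hs, hs', and_self]
    exact (Finset.mem_union.1 hw).resolve_right fun h => hCS w h hwS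
  · intro u hu w hw huw
    by_cases huX : u ∈ X
    · exact Or.inl (Finset.mem_union_left _ huX)
    · exact Or.inr (hcl u hu huX w huw)
  · rintro (t | t)
    · exact hD t
    · exact hD' t

/-- The hard direction of the tree-width duality theorem of Seymour and Thomas: if every bramble
has a cover of size at most `k`, there is a tree decomposition with bags of size at most `k`. -/
theorem exists_treeDec_card_le {k : ℕ}
    (hk : ∀ B, H.IsBramble B → ∃ X : Finset V, X.card ≤ k ∧ Covers X B) :
    ∃ D : TreeDec H Finset.univ, ∀ t, (D.bag t).card ≤ k := by
  obtain ⟨D, hD⟩ := exists_admissible_treeDec hk ∅ ⟨fun _ h => h.elim, fun _ h => h.elim⟩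
  exact ⟨D, fun t => (hD t).resolve_right fun h => h fun _ h' => h'.elim⟩

end

end SimpleGraph

/-! ### Scramble number and treewidth -/

namespace HalfEdgeGraph

open SimpleGraph

variable {X : Type*} (G : HalfEdgeGraph X)

theorem exists_halfEdge_of_adj {u v : G.V} (h : G.adjGraph.Adj u v) :
    ∃ e, G.i e ≠ e ∧ G.root e = u ∧ G.root (G.i e) = v := h.2

variable [Fintype X] [DecidableEq X]

/-- A bramble all of whose covers have more than `w` elements is a scramble of order at least
`w`. -/
theorem le_scrambleNumber_of_bramble {B : Set (Set G.V)} (hB : G.adjGraph.IsBramble B) {w : ℕ}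
    (hw : ∀ C : Finset G.V, Covers C B → w < C.card) : w ≤ G.scrambleNumber := by
  classical
  let S : G.Scramble := ⟨B, fun E hE => connOn_iff.1 (hB.1 E hE)⟩
  have hmem : w ∈ S.orderSet := by
    refine ⟨fun C hC => (hw C hC).le, ?_⟩
    rintro A ⟨E, hE, hEA⟩ hA'
    let Q : Finset X :=
      Finset.univ.filter fun e => G.i e ≠ e ∧ G.root e ∈ A ∧ G.root (G.i e) ∉ A
    have hQ : G.cutSize A = Q.card := by
      rw [cutSize, ← Set.ncard_coe_finset]
      congr 1
      ext e
      simp [Q]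
    have touch : ∀ F ∈ B, F ⊆ A → ∀ F' ∈ B, F' ⊆ Aᶜ →
        ∃ e ∈ Q, G.root e ∈ F ∧ G.root (G.i e) ∈ F' := by
      intro F hF hFA F' hF' hFA'
      obtain ⟨u, hu, v, hv, rfl | huv⟩ := hB.2 F hF F' hF'
      · exact absurd (hFA hu) (hFA' hv)
      · obtain ⟨e, he, rfl, rfl⟩ := G.exists_halfEdge_of_adj huv
        exact ⟨e, Finset.mem_filter.2 ⟨Finset.mem_univ _, he, hFA hu, hFA' hv⟩, hu, hv⟩
    let inc : Set G.V → Finset X := fun F => Q.filter fun e => G.root (G.i e) ∈ F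
    -- Among the eggs outside `A`, `E'` is incident with an inclusion-minimal set of cut edges.
    obtain ⟨E', ⟨hE', hEA'⟩, hmin⟩ :=
      (Set.toFinite {F | F ∈ B ∧ F ⊆ Aᶜ}).exists_minimalFor inc _ hA'
    obtain ⟨e₀, he₀, -, he₀'⟩ := touch E hE hEA E' hE' hEA'
    -- One end of each cut edge: the end in `A` if the other end lies in `E'`, the end outside `A`
    -- otherwise. The extra vertex serves the eggs outside `A` with the same cut edges as `E'`, and
    -- accounts for the `+ 1`.
    let C : Finset G.V :=
      insert (G.root (G.i e₀))
        (Q.image fun e => if e ∈ inc E' then G.root e else G.root (G.i e))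
    have hC : Covers C B := by
      intro F hF
      have mem : ∀ e ∈ Q, (if e ∈ inc E' then G.root e else G.root (G.i e)) ∈ C := fun e he =>
        Finset.mem_insert_of_mem (Finset.mem_image_of_mem _ he)
      by_cases hFA : F ⊆ A
      · obtain ⟨e, he, h1, h2⟩ := touch F hF hFA E' hE' hEA'
        refine ⟨_, mem e he, ?_⟩
        rwa [if_pos (Finset.mem_filter.2 ⟨he, h2⟩)]
      by_cases hFA' : F ⊆ Aᶜ
      · by_cases hinc : inc F ≤ inc E'
        · have h := hmin (j := F) ⟨hF, hFA'⟩ hinc (Finset.mem_filter.2 ⟨he₀, he₀'⟩)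
          exact ⟨_, Finset.mem_insert_self _ _, (Finset.mem_filter.1 h).2⟩
        · obtain ⟨e, he, he'⟩ := Finset.not_subset.1 hinc
          refine ⟨_, mem e (Finset.mem_filter.1 he).1, ?_⟩
          rw [if_neg he']
          exact (Finset.mem_filter.1 he).2
      · obtain ⟨a, ha, haA⟩ := Set.not_subset.1 hFA'
        obtain ⟨b, hb, hbA⟩ := Set.not_subset.1 hFA
        obtain ⟨u, hu, v, hv, huA, hvA, huv⟩ :=
          (hB.1 F hF).2 A ⟨a, ha, not_not.1 haA⟩ ⟨b, hb, hbA⟩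
        obtain ⟨e, he, rfl, rfl⟩ := G.exists_halfEdge_of_adj huv
        refine ⟨_, mem e (Finset.mem_filter.2 ⟨Finset.mem_univ _, he, huA, hvA⟩), ?_⟩
        split_ifs
        · exact hu
        · exact hv
    have h1 := hw C hC
    have h2 : C.card ≤ Q.card + 1 :=
      (Finset.card_insert_le _ _).trans (Nat.add_le_add_right Finset.card_image_le 1)
    omega
  exact (S.isGreatest_order.2 hmem).trans (G.isGreatest_scrambleNumber.2 ⟨S, rfl⟩)

theorem treewidth_le_of_treeDec (D : TreeDec G.adjGraph Finset.univ) {k : ℕ}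
    (hD : ∀ t, (D.bag t).card ≤ k) : G.treewidth ≤ k - 1 := by
  let T : G.TreeDecomposition :=
    { Node := D.Node
      fintypeNode := D.fintypeNode
      tree := D.tree
      isTree := D.isTree
      bag := D.bag
      edge_mem := fun e he => by
        -- Loops are invisible in `adjGraph`; any bag containing their vertex will do.
        by_cases h : G.root e = G.root (G.i e)
        · obtain ⟨t, ht⟩ := (D.subtree (G.root e) (Finset.mem_univ _)).1
          exact ⟨t, ht, h ▸ ht⟩
        · exact D.exists_bag _ (Finset.mem_univ _) _ (Finset.mem_univ _) ⟨h, e, he, rfl, rfl⟩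
      subtree := fun v => connOn_iff.1 (D.subtree v (Finset.mem_univ _)) }
  refine (G.isLeast_treewidth.2 ⟨T, rfl⟩).trans (Nat.sub_le_sub_right ?_ 1)
  exact Finset.sup_le fun t _ => hD t

/-- Were the treewidth `w` larger than the scramble number, every bramble would have a cover with at
most `w` vertices, and duality would give a decomposition of width at most `w - 1`. Here `w` is
positive, so the subtraction does not truncate. -/
theorem treewidth_le_scrambleNumber : G.treewidth ≤ G.scrambleNumber := by
  by_contra! hlt
  obtain ⟨D, hD⟩ := exists_treeDec_card_le (H := G.adjGraph) (k := G.treewidth) fun B hB => by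
    by_contra! hno
    refine hlt.not_ge (G.le_scrambleNumber_of_bramble hB fun C hC => ?_)
    by_contra h
    exact hno C (not_lt.1 h) hC
  have := G.treewidth_le_of_treeDec D hD
  omega

end HalfEdgeGraph

/-! ### A total preorder on the groupification -/

open Algebra (GrothendieckAddGroup)

/-- In a finite set there is an element with the smallest value with respect to a total cone. -/
theorem AddSubmonoid.exists_least_of_total {A ι : Type*} [AddCommGroup A] {P : AddSubmonoid A}
    (hP : ∀ x, x ∈ P ∨ -x ∈ P) {s : Set ι} (hs : s.Finite) (hne : s.Nonempty) (h : ι → A) :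
    ∃ x ∈ s, ∀ y ∈ s, h y - h x ∈ P := by
  let _ : Preorder A :=
    { le := fun x y => y - x ∈ P
      le_refl := fun x => by
        rw [sub_self]
        exact P.zero_mem
      le_trans := fun x y z hxy hyz => by
        have := P.add_mem hyz hxy
        rwa [sub_add_sub_cancel] at this }
  obtain ⟨x, hx, hmin⟩ := hs.exists_minimalFor h s hne
  refine ⟨x, hx, fun y hy => ?_⟩
  rcases hP (h y - h x) with h' | h'
  · exact h'
  · rw [neg_sub] at h'
    exact hmin hy h'

/-- The groupification of a sharp integral monoid has a total cone in which the non-zero elements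
of the monoid are strictly positive. -/
theorem exists_total_cone (M : Type*) [AddCancelCommMonoid M] [Subsingleton (AddUnits M)] :
    ∃ P : AddSubmonoid (GrothendieckAddGroup M), (∀ x, x ∈ P ∨ -x ∈ P) ∧
      ∀ m : M, GrothendieckAddGroup.of m ∈ P ∧ (m ≠ 0 → -GrothendieckAddGroup.of m ∉ P) := by
  have sharp : ∀ a b : M, a + b = 0 → a = 0 := fun a b h =>
    congrArg AddUnits.val
      (Subsingleton.elim (⟨a, b, h, by rw [add_comm]; exact h⟩ : AddUnits M) 0)
  have nsmul_ne : ∀ (n : ℕ) (m : M), n ≠ 0 → m ≠ 0 → n • m ≠ 0 := by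
    intro n m hn hm h
    obtain ⟨n, rfl⟩ := Nat.exists_eq_succ_of_ne_zero hn
    rw [succ_nsmul'] at h
    exact hm (sharp _ _ h)
  -- A maximal cone above the image of `M`. The groupification may have torsion, so `P ∩ -P` may be
  -- non-trivial and only a preorder can be expected.
  obtain ⟨P, -, hP⟩ := zorn_le_nonempty₀
    {P : AddSubmonoid (GrothendieckAddGroup M) | ∀ m : M, GrothendieckAddGroup.of m ∈ P ∧
      (m ≠ 0 → -GrothendieckAddGroup.of m ∉ P)}
    (by
      intro c hc hchain Q hQ
      refine ⟨sSup c, fun m => ⟨le_sSup hQ (hc hQ m).1, fun hm h => ?_⟩, fun z hz => le_sSup hz⟩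
      obtain ⟨R, hR, hmR⟩ :=
        (AddSubmonoid.mem_sSup_of_directedOn ⟨Q, hQ⟩ hchain.directedOn).1 h
      exact (hc hR m).2 hm hmR)
    (AddMonoidHom.mrange GrothendieckAddGroup.of)
    (by
      refine fun m => ⟨⟨m, rfl⟩, fun hm ⟨m', hm'⟩ => hm ?_⟩
      by_contra h
      have : m' + m ≠ 0 := fun h' => h (sharp m m' (by rw [add_comm]; exact h'))
      refine absurd (MetrisedGraph.eq_zero_of_zsmul_of this (n := 1) ?_) one_ne_zero
      rw [one_smul, map_add, hm', neg_add_cancel])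
  -- By maximality, adjoining `x` to `P` makes some `-m` with `m ≠ 0` appear.
  have ext : ∀ x, x ∉ P → ∃ p ∈ P, ∃ n : ℕ, n ≠ 0 ∧ ∃ m : M, m ≠ 0 ∧
      p + n • x = -GrothendieckAddGroup.of m := by
    intro x hx
    have hle : ¬ (P ⊔ AddSubmonoid.closure {x}) ≤ P := fun h =>
      hx (h (le_sup_right (a := P) (AddSubmonoid.subset_closure rfl)))
    have hnot : ¬ ∀ m : M, GrothendieckAddGroup.of m ∈ P ⊔ AddSubmonoid.closure {x} ∧
        (m ≠ 0 → -GrothendieckAddGroup.of m ∉ P ⊔ AddSubmonoid.closure {x}) := fun h =>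
      hle (hP.2 h le_sup_left)
    push Not at hnot
    obtain ⟨m, hm⟩ := hnot
    obtain ⟨hm0, hm⟩ := hm (le_sup_left (a := P) (hP.1 m).1)
    obtain ⟨p, hp, y, hy, hpy⟩ := AddSubmonoid.mem_sup.1 hm
    obtain ⟨n, rfl⟩ := AddSubmonoid.mem_closure_singleton.1 hy
    refine ⟨p, hp, n, ?_, m, hm0, hpy⟩
    rintro rfl
    rw [zero_smul, add_zero] at hpy
    exact (hP.1 m).2 hm0 (hpy ▸ hp)
  refine ⟨P, fun x => ?_, hP.1⟩
  by_contra! hx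
  obtain ⟨p, hp, n, hn, m, hm, h1⟩ := ext x hx.1
  obtain ⟨q, hq, n', hn', m', hm', h2⟩ := ext (-x) hx.2
  -- Combining the two relations with weights `n'` and `n` eliminates `x` and puts the negative of
  -- this element into `P`.
  have hne : n' • m + n • m' ≠ 0 := fun h => nsmul_ne n' m hn' hm (sharp _ _ h)
  refine (hP.1 _).2 hne ?_
  have hmem := P.add_mem (P.nsmul_mem hp n') (P.nsmul_mem hq n)
  convert hmem using 1
  rw [eq_sub_of_add_eq h1, eq_sub_of_add_eq h2, map_add, map_nsmul, map_nsmul, smul_neg,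
    sub_neg_eq_add, smul_sub, smul_add, smul_neg, smul_neg, smul_smul, smul_smul, mul_comm n' n]
  abel

/-! ### Chip configurations on the tropical curve -/

namespace MetrisedGraph

variable {X M : Type*} [Fintype X] [DecidableEq X] [AddCancelCommMonoid M]

/-- An effective divisor, possibly with chips in the interior of edges, that is equivalent to `D`
on the tropical curve of `Γ`: `f` is the potential at the vertices and `a e` an upper bound for the
slope of `f` at the start of the half-edge `e`. -/
structure Chips (Γ : MetrisedGraph X M) (P : AddSubmonoid (GrothendieckAddGroup M))
    (D : Γ.Divisor) where
  f : Γ.toHalfEdgeGraph.V → GrothendieckAddGroup M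
  a : X → ℤ
  slope_le : ∀ e, Γ.i e ≠ e → a e • Γ.lengthGp e - (f (Γ.root e) - f (Γ.root (Γ.i e))) ∈ P
  effective : ∀ v, ∑ e ∈ Γ.halfEdgesAt v, a e ≤ D v

namespace Chips

variable {Γ : MetrisedGraph X M} {P : AddSubmonoid (GrothendieckAddGroup M)} {D : Γ.Divisor}

/-- The number of chips at a vertex. -/
def chip (s : Chips Γ P D) (v : Γ.toHalfEdgeGraph.V) : ℤ := D v - ∑ e ∈ Γ.halfEdgesAt v, s.a e

/-- There is a chip at a vertex of `E` or in the interior of an edge with both ends in `E`. -/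
def Hits (s : Chips Γ P D) (E : Set Γ.toHalfEdgeGraph.V) : Prop :=
  (∃ v ∈ E, 0 < s.chip v) ∨
    ∃ e, Γ.i e ≠ e ∧ Γ.root e ∈ E ∧ Γ.root (Γ.i e) ∈ E ∧ 0 < s.a e + s.a (Γ.i e)

theorem chip_nonneg (s : Chips Γ P D) (v : Γ.toHalfEdgeGraph.V) : 0 ≤ s.chip v :=
  sub_nonneg.2 (s.effective v)

theorem mem_halfEdgesAt {e : X} {v : Γ.toHalfEdgeGraph.V} :
    e ∈ Γ.halfEdgesAt v ↔ Γ.i e ≠ e ∧ Γ.root e = v := by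
  simp [HalfEdgeGraph.halfEdgesAt]

omit [Fintype X] [DecidableEq X] in
theorem i_i_ne {e : X} (he : Γ.i e ≠ e) : Γ.i (Γ.i e) ≠ Γ.i e := by
  rw [Γ.i_invol]
  exact he.symm

theorem chip_mono (s t : Chips Γ P D) {v : Γ.toHalfEdgeGraph.V}
    (h : ∀ e, Γ.root e = v → s.a e ≤ t.a e) : t.chip v ≤ s.chip v :=
  sub_le_sub_left (Finset.sum_le_sum fun e he => h e (mem_halfEdgesAt.1 he).2) _

theorem chip_pos (s t : Chips Γ P D) {e : X} (he : Γ.i e ≠ e)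
    (h : ∀ e', Γ.root e' = Γ.root e → s.a e' ≤ t.a e') (hlt : s.a e < t.a e) :
    0 < s.chip (Γ.root e) :=
  (t.chip_nonneg _).trans_lt <| sub_lt_sub_left (Finset.sum_lt_sum
    (fun e he => h e (mem_halfEdgesAt.1 he).2) ⟨e, mem_halfEdgesAt.2 ⟨he, rfl⟩, hlt⟩) _

/-- Adding a constant to the potential. -/
def shift (s : Chips Γ P D) (c : GrothendieckAddGroup M) : Chips Γ P D where
  f v := s.f v + c
  a := s.a
  slope_le e he := by
    rw [add_sub_add_right_eq_sub]
    exact s.slope_le e he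
  effective := s.effective

/-- The pointwise maximum of two potentials. -/
theorem exists_max (htot : ∀ x, x ∈ P ∨ -x ∈ P) (s t : Chips Γ P D) (a : X → ℤ)
    (ha : ∀ e, (a e = s.a e ∧ s.f (Γ.root e) - t.f (Γ.root e) ∈ P) ∨
      (a e = t.a e ∧ t.f (Γ.root e) - s.f (Γ.root e) ∈ P))
    (heff : ∀ v, ∑ e ∈ Γ.halfEdgesAt v, a e ≤ D v) : ∃ r : Chips Γ P D, r.a = a := by
  have hg : ∀ v, ∃ x, x - s.f v ∈ P ∧ x - t.f v ∈ P ∧ (s.f v - t.f v ∈ P → s.f v - x ∈ P) ∧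
      (t.f v - s.f v ∈ P → t.f v - x ∈ P) := by
    intro v
    have h0 : ∀ y : GrothendieckAddGroup M, y - y ∈ P := fun y => by
      rw [sub_self]
      exact P.zero_mem
    rcases htot (s.f v - t.f v) with h | h
    · exact ⟨s.f v, h0 _, h, fun _ => h0 _, id⟩
    · rw [neg_sub] at h
      exact ⟨t.f v, h, h0 _, id, fun _ => h0 _⟩
  choose g hgs hgt hgs' hgt' using hg
  refine ⟨⟨g, a, fun e he => ?_, heff⟩, rfl⟩
  -- The chosen potential attains the maximum at `root e` and is at most the maximum at the other
  -- end, so its slope bound remains valid.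
  rcases ha e with ⟨h, h'⟩ | ⟨h, h'⟩
  · rw [h]
    have := P.add_mem (P.add_mem (s.slope_le e he) (hgs' _ h')) (hgs (Γ.root (Γ.i e)))
    convert this using 1
    abel
  · rw [h]
    have := P.add_mem (P.add_mem (t.slope_le e he) (hgt' _ h')) (hgt (Γ.root (Γ.i e)))
    convert this using 1
    abel

section

variable (hl : ∀ e, Γ.i e ≠ e → Γ.lengthGp e ∈ P ∧ -Γ.lengthGp e ∉ P)
include hl

omit [Fintype X] [DecidableEq X] in
theorem nonneg_of_zsmul_mem {e : X} (he : Γ.i e ≠ e) {n : ℤ} (h : n • Γ.lengthGp e ∈ P) :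
    0 ≤ n := by
  by_contra! hn
  obtain ⟨k, rfl⟩ : ∃ k : ℕ, n = -(k + 1 : ℤ) := ⟨(-n - 1).toNat, by omega⟩
  refine (hl e he).2 ?_
  have := P.add_mem h (P.nsmul_mem (hl e he).1 k)
  convert this using 1
  rw [neg_smul, add_smul, one_smul, natCast_zsmul]
  abel

/-- Adding the slope bounds of `s` along `e` and of `t` along `i e` bounds `s.a e + t.a (i e)` times
the length from below by `s - t` at `root e` plus `t - s` at the other end. For the maximum of `s`
and `t`, this number counts the chips inside the edge. -/
theorem mixed_nonneg_and_pos (s t : Chips Γ P D) {e : X} (he : Γ.i e ≠ e)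
    (h : s.f (Γ.root e) - t.f (Γ.root e) ∈ P)
    (h' : t.f (Γ.root (Γ.i e)) - s.f (Γ.root (Γ.i e)) ∈ P) :
    0 ≤ s.a e + t.a (Γ.i e) ∧
      ((t.f (Γ.root e) - s.f (Γ.root e) ∉ P ∨ s.f (Γ.root (Γ.i e)) - t.f (Γ.root (Γ.i e)) ∉ P) →
        0 < s.a e + t.a (Γ.i e)) := by
  have h1 := s.slope_le e he
  have h2 := t.slope_le (Γ.i e) (i_i_ne he)
  have hle : Γ.lengthGp (Γ.i e) = Γ.lengthGp e := congrArg GrothendieckAddGroup.of (Γ.l_i e)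
  rw [Γ.i_invol, hle] at h2
  have h0 : 0 ≤ s.a e + t.a (Γ.i e) := by
    refine nonneg_of_zsmul_mem hl he ?_
    convert P.add_mem (P.add_mem h1 h2) (P.add_mem h h') using 1
    rw [add_smul]
    abel
  refine ⟨h0, fun hne => lt_of_le_of_ne h0 fun heq => ?_⟩
  have ht : t.a (Γ.i e) = -s.a e := by omega
  rw [ht, neg_smul] at h2
  rcases hne with hne | hne
  · refine hne ?_
    convert P.add_mem (P.add_mem h1 h2) h' using 1
    abel
  · refine hne ?_
    convert P.add_mem (P.add_mem h1 h2) h using 1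
    abel

theorem add_a_i_nonneg (s : Chips Γ P D) {e : X} (he : Γ.i e ≠ e) : 0 ≤ s.a e + s.a (Γ.i e) :=
  (mixed_nonneg_and_pos hl s s he (by rw [sub_self]; exact P.zero_mem)
    (by rw [sub_self]; exact P.zero_mem)).1

/-- The total number of chips is at most the degree. -/
theorem sum_chip_add_sum_le_deg (s : Chips Γ P D) (Q : Finset X)
    (hQ : ∀ e ∈ Q, Γ.i e ≠ e ∧ Γ.i e ∉ Q) :
    ∑ v, s.chip v + ∑ e ∈ Q, (s.a e + s.a (Γ.i e)) ≤ deg D := by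
  set F : Finset X := Finset.univ.filter fun e => Γ.i e ≠ e with hF
  have h1 : ∑ v, s.chip v = deg D - ∑ e ∈ F, s.a e := by
    rw [deg, ← Finset.sum_fiberwise_of_maps_to (t := Finset.univ) (g := Γ.root)
      (fun _ _ => Finset.mem_univ _), ← Finset.sum_sub_distrib]
    refine Finset.sum_congr rfl fun v _ => ?_
    rw [chip, HalfEdgeGraph.halfEdgesAt, Finset.filter_filter]
  have hinv : Function.Injective Γ.i := Function.Involutive.injective Γ.i_invol
  have h2 : ∑ e ∈ F, s.a (Γ.i e) = ∑ e ∈ F, s.a e := by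
    refine Finset.sum_nbij' Γ.i Γ.i ?_ ?_ ?_ ?_ ?_ <;> simp +contextual [hF, Γ.i_invol, eq_comm]
  -- Both half-edges are summed over, so each edge counts twice; the factor cancels at the end.
  have h3 : ∑ e ∈ Q ∪ Q.image Γ.i, (s.a e + s.a (Γ.i e)) ≤ ∑ e ∈ F, (s.a e + s.a (Γ.i e)) := by
    refine Finset.sum_le_sum_of_subset_of_nonneg ?_ fun e he _ =>
      s.add_a_i_nonneg hl (Finset.mem_filter.1 he).2
    intro e he
    refine Finset.mem_filter.2 ⟨Finset.mem_univ _, ?_⟩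
    rcases Finset.mem_union.1 he with he | he
    · exact (hQ e he).1
    · obtain ⟨e', he', rfl⟩ := Finset.mem_image.1 he
      exact i_i_ne (hQ e' he').1
  have hdisj : Disjoint Q (Q.image Γ.i) := by
    rw [Finset.disjoint_left]
    intro e he he'
    obtain ⟨e', hmem, rfl⟩ := Finset.mem_image.1 he'
    exact (hQ e' hmem).2 he
  rw [Finset.sum_union hdisj, Finset.sum_image hinv.injOn, Finset.sum_add_distrib (s := F), h2]
    at h3
  have h4 : ∑ e ∈ Q, (s.a (Γ.i e) + s.a (Γ.i (Γ.i e))) = ∑ e ∈ Q, (s.a e + s.a (Γ.i e)) :=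
    Finset.sum_congr rfl fun e _ => by rw [Γ.i_invol, add_comm]
  omega

/-- The vertices with a chip, together with an end of every edge with a chip in its interior. -/
theorem exists_cover (s : Chips Γ P D) : ∃ C : Finset Γ.toHalfEdgeGraph.V,
    (C.card : ℤ) ≤ deg D ∧ ∀ E, s.Hits E → ∃ v ∈ C, v ∈ E := by
  -- An arbitrary enumeration selects one half-edge of each edge.
  let idx := Fintype.equivFin X
  let Q : Finset X := Finset.univ.filter fun e => idx e < idx (Γ.i e) ∧ 0 < s.a e + s.a (Γ.i e)
  have hQ : ∀ e ∈ Q, Γ.i e ≠ e ∧ Γ.i e ∉ Q := by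
    intro e he
    have h1 := (Finset.mem_filter.1 he).2.1
    refine ⟨fun h => ?_, fun h => ?_⟩
    · rw [h] at h1
      exact lt_irrefl _ h1
    · have h2 := (Finset.mem_filter.1 h).2.1
      rw [Γ.i_invol] at h2
      exact lt_asymm h1 h2
  let W : Finset Γ.toHalfEdgeGraph.V := Finset.univ.filter fun v => 0 < s.chip v
  refine ⟨W ∪ Q.image Γ.root, ?_, ?_⟩
  · have h1 : (W.card : ℤ) ≤ ∑ v, s.chip v := by
      refine le_trans ?_ (Finset.sum_le_sum_of_subset_of_nonneg (Finset.subset_univ W)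
        fun v _ _ => s.chip_nonneg v)
      rw [Finset.card_eq_sum_ones, Nat.cast_sum]
      exact Finset.sum_le_sum fun v hv => by
        simpa using Int.add_one_le_iff.2 (Finset.mem_filter.1 hv).2
    have h2 : (Q.card : ℤ) ≤ ∑ e ∈ Q, (s.a e + s.a (Γ.i e)) := by
      rw [Finset.card_eq_sum_ones, Nat.cast_sum]
      exact Finset.sum_le_sum fun v hv => by
        simpa using Int.add_one_le_iff.2 (Finset.mem_filter.1 hv).2.2
    have h3 := s.sum_chip_add_sum_le_deg hl Q hQ
    have h4 := Finset.card_union_le W (Q.image Γ.root)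
    have h5 := Finset.card_image_le (s := Q) (f := Γ.root)
    omega
  · rintro E (⟨v, hv, hpos⟩ | ⟨e, he, h1, h2, hpos⟩)
    · exact ⟨v, Finset.mem_union_left _ (Finset.mem_filter.2 ⟨Finset.mem_univ _, hpos⟩), hv⟩
    · rcases lt_or_gt_of_ne (fun h => he (idx.injective h) : idx (Γ.i e) ≠ idx e) with h | h
      · refine ⟨Γ.root (Γ.i e), Finset.mem_union_right _ (Finset.mem_image_of_mem _
          (Finset.mem_filter.2 ⟨Finset.mem_univ _, ?_, ?_⟩)), h2⟩
        · rwa [Γ.i_invol]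
        · rwa [Γ.i_invol, add_comm]
      · exact ⟨Γ.root e, Finset.mem_union_right _ (Finset.mem_image_of_mem _
          (Finset.mem_filter.2 ⟨Finset.mem_univ _, h, hpos⟩)), h1⟩

/-- Level sets of the difference of two potentials have small boundary. -/
theorem cutSize_le_deg (htot : ∀ x, x ∈ P ∨ -x ∈ P) (s t : Chips Γ P D) :
    (Γ.cutSize {v | s.f v - t.f v ∈ P} : ℤ) ≤ deg D := by
  classical
  set U : Set Γ.toHalfEdgeGraph.V := {v | s.f v - t.f v ∈ P} with hU
  have hU' : ∀ v, v ∉ U → t.f v - s.f v ∈ P := fun v hv => by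
    have := (htot (s.f v - t.f v)).resolve_left hv
    rwa [neg_sub] at this
  -- The maximum takes its slopes from `s` on `U` and from `t` elsewhere, hence has a chip inside
  -- every cut edge.
  obtain ⟨r, hr⟩ := exists_max htot s t (fun e => if Γ.root e ∈ U then s.a e else t.a e)
    (fun e => by
      by_cases h : Γ.root e ∈ U
      · exact Or.inl ⟨if_pos h, h⟩
      · exact Or.inr ⟨if_neg h, hU' _ h⟩)
    (fun v => by
      by_cases h : v ∈ U
      · refine le_of_eq_of_le (Finset.sum_congr rfl fun e he => ?_) (s.effective v)
        rw [(mem_halfEdgesAt.1 he).2, if_pos h]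
      · refine le_of_eq_of_le (Finset.sum_congr rfl fun e he => ?_) (t.effective v)
        rw [(mem_halfEdgesAt.1 he).2, if_neg h])
  let Q : Finset X := Finset.univ.filter fun e =>
    Γ.i e ≠ e ∧ Γ.root e ∈ U ∧ Γ.root (Γ.i e) ∉ U
  have hcard : Γ.cutSize U = Q.card := by
    rw [HalfEdgeGraph.cutSize, ← Set.ncard_coe_finset]
    congr 1
    ext e
    simp [Q]
  have h1 := r.sum_chip_add_sum_le_deg hl Q fun e he =>
    ⟨(Finset.mem_filter.1 he).2.1, fun h =>
      (Finset.mem_filter.1 he).2.2.2 (Finset.mem_filter.1 h).2.2.1⟩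
  have h2 : (Q.card : ℤ) ≤ ∑ e ∈ Q, (r.a e + r.a (Γ.i e)) := by
    rw [Finset.card_eq_sum_ones, Nat.cast_sum]
    refine Finset.sum_le_sum fun e he => ?_
    obtain ⟨-, he, hu, hw⟩ := Finset.mem_filter.1 he
    have := (mixed_nonneg_and_pos hl s t he hu (hU' _ hw)).2 (Or.inr hw)
    simp only [hr, if_pos hu, if_neg hw, Nat.cast_one]
    omega
  have h3 : 0 ≤ ∑ v, r.chip v := Finset.sum_nonneg fun v _ => r.chip_nonneg v
  omega

/-- The larger potential changes along `e`, so `s.a e + t.a (i e)` is positive. If `r` keeps the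
slope of `t` at the far end, this is a chip inside the edge; if `r` has a smaller slope there, the
difference is a chip at the far vertex. -/
theorem hits_of_crossing (s t r : Chips Γ P D) {E : Set Γ.toHalfEdgeGraph.V} {e : X}
    (he : Γ.i e ≠ e) (hu : Γ.root e ∈ E) (hw : Γ.root (Γ.i e) ∈ E)
    (h : s.f (Γ.root e) - t.f (Γ.root e) ∈ P) (hn : t.f (Γ.root e) - s.f (Γ.root e) ∉ P)
    (h' : t.f (Γ.root (Γ.i e)) - s.f (Γ.root (Γ.i e)) ∈ P) (h1 : r.a e = s.a e)
    (h2 : ∀ e', Γ.root e' = Γ.root (Γ.i e) → r.a e' ≤ t.a e') : r.Hits E := by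
  have hpos := (mixed_nonneg_and_pos hl s t he h h').2 (Or.inl hn)
  rcases (h2 _ rfl).lt_or_eq with hlt | heq
  · exact Or.inl ⟨_, hw, r.chip_pos t (i_i_ne he) h2 hlt⟩
  · exact Or.inr ⟨e, he, hu, hw, by rw [h1, heq]; exact hpos⟩

end

/-- If no cut with at most `deg D` edges separates two eggs, then all the eggs hit by `s`, or by `t`
at a vertex, can be hit simultaneously. -/
theorem exists_join (htot : ∀ x, x ∈ P ∨ -x ∈ P)
    (hl : ∀ e, Γ.i e ≠ e → Γ.lengthGp e ∈ P ∧ -Γ.lengthGp e ∉ P)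
    {S : Set (Set Γ.toHalfEdgeGraph.V)} (hS : ∀ E ∈ S, Γ.adjGraph.ConnOn E)
    (hcut : ∀ U : Set Γ.toHalfEdgeGraph.V, (∃ E ∈ S, E ⊆ U) → (∃ E ∈ S, E ⊆ Uᶜ) →
      deg D < Γ.cutSize U) (s t₀ : Chips Γ P D) :
    ∃ r : Chips Γ P D, (∀ E ∈ S, s.Hits E → r.Hits E) ∧
      ∀ E ∈ S, (∃ v ∈ E, 0 < t₀.chip v) → r.Hits E := by
  classical
  rcases S.eq_empty_or_nonempty with rfl | hne
  · exact ⟨s, fun _ h => h.elim, fun _ h => h.elim⟩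
  have hmin : ∀ E : Set Γ.toHalfEdgeGraph.V, ∃ x, E ∈ S → x ∈ E ∧
      ∀ y ∈ E, (s.f y - t₀.f y) - (s.f x - t₀.f x) ∈ P := by
    intro E
    by_cases hE : E ∈ S
    · obtain ⟨x, hx, h⟩ := P.exists_least_of_total htot (Set.toFinite E) (hS E hE).1
        fun v => s.f v - t₀.f v
      exact ⟨x, fun _ => ⟨hx, h⟩⟩
    · obtain ⟨E', hE'⟩ := hne
      exact ⟨(hS E' hE').1.some, fun h => absurd h hE⟩
  choose m hm using hmin
  -- `m E` minimises `s - t₀` on `E`, and `E₀` is an egg for which this minimum is largest. The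
  -- shift makes the potentials equal at `m E₀`: then `s` dominates on all of `E₀`, and `t`
  -- dominates somewhere on every egg.
  obtain ⟨E₀, hE₀, hmax⟩ := P.exists_least_of_total htot (Set.toFinite S) hne
    fun E => -(s.f (m E) - t₀.f (m E))
  let t : Chips Γ P D := t₀.shift (s.f (m E₀) - t₀.f (m E₀))
  have ht : ∀ v, t.f v = t₀.f v + (s.f (m E₀) - t₀.f (m E₀)) := fun _ => rfl
  have tot : ∀ v, s.f v - t.f v ∈ P ∨ t.f v - s.f v ∈ P := fun v => by
    have := htot (s.f v - t.f v)
    rwa [neg_sub] at this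
  -- every egg has a vertex where the maximum is attained by `t`
  have meet_t : ∀ E ∈ S, ∃ v ∈ E, t.f v - s.f v ∈ P := by
    intro E hE
    refine ⟨m E, (hm E hE).1, ?_⟩
    convert hmax E hE using 1
    rw [ht]
    abel
  -- every egg has a vertex where the maximum is attained by `s`
  have meet_s : ∀ E ∈ S, ∃ v ∈ E, s.f v - t.f v ∈ P := by
    intro E hE
    by_contra! hno
    refine (hcut {v | s.f v - t.f v ∈ P} ⟨E₀, hE₀, fun v hv => ?_⟩
      ⟨E, hE, fun v hv => hno v hv⟩).not_ge (cutSize_le_deg hl htot s t)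
    have := (hm E₀ hE₀).2 v hv
    change s.f v - t.f v ∈ P
    convert this using 1
    rw [ht]
    abel
  -- Where the potentials tie, the smaller slope leaves at least as many chips at the vertex as `s`
  -- and `t` both have.
  let a : X → ℤ := fun e =>
    if t.f (Γ.root e) - s.f (Γ.root e) ∉ P then s.a e
    else if s.f (Γ.root e) - t.f (Γ.root e) ∉ P then t.a e else min (s.a e) (t.a e)
  have a_s : ∀ e, t.f (Γ.root e) - s.f (Γ.root e) ∉ P → a e = s.a e := fun e h => if_pos h
  have a_t : ∀ e, s.f (Γ.root e) - t.f (Γ.root e) ∉ P → a e = t.a e := fun e h => by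
    have h' := (tot _).resolve_left h
    simp only [a, h, h', not_true_eq_false, not_false_eq_true, if_true, if_false]
  have a_min : ∀ e, s.f (Γ.root e) - t.f (Γ.root e) ∈ P → t.f (Γ.root e) - s.f (Γ.root e) ∈ P →
      a e = min (s.a e) (t.a e) := fun e h h' => by
    simp only [a, h, h', not_true_eq_false, if_false]
  have le_s : ∀ v, s.f v - t.f v ∈ P → ∀ e, Γ.root e = v → a e ≤ s.a e := by
    rintro _ h e rfl
    by_cases h' : t.f (Γ.root e) - s.f (Γ.root e) ∈ P
    · exact (a_min e h h').trans_le (min_le_left _ _)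
    · exact (a_s e h').le
  have le_t : ∀ v, t.f v - s.f v ∈ P → ∀ e, Γ.root e = v → a e ≤ t.a e := by
    rintro _ h e rfl
    by_cases h' : s.f (Γ.root e) - t.f (Γ.root e) ∈ P
    · exact (a_min e h' h).trans_le (min_le_right _ _)
    · exact (a_t e h').le
  clear_value a
  obtain ⟨r, rfl⟩ := exists_max htot s t a
    (fun e => by
      by_cases h : t.f (Γ.root e) - s.f (Γ.root e) ∈ P
      · by_cases h' : s.f (Γ.root e) - t.f (Γ.root e) ∈ P
        · rw [a_min e h' h]
          rcases min_choice (s.a e) (t.a e) with hc | hc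
          · exact Or.inl ⟨hc, h'⟩
          · exact Or.inr ⟨hc, h⟩
        · exact Or.inr ⟨a_t e h', h⟩
      · exact Or.inl ⟨a_s e h, (tot _).resolve_right h⟩)
    (fun v => by
      rcases tot v with h | h
      · exact (Finset.sum_le_sum fun e he => le_s v h e (mem_halfEdgesAt.1 he).2).trans
          (s.effective v)
      · exact (Finset.sum_le_sum fun e he => le_t v h e (mem_halfEdgesAt.1 he).2).trans
          (t.effective v))
  -- an egg on which the two potentials do not agree is hit
  have hits : ∀ E ∈ S, (∃ v ∈ E, ¬ (s.f v - t.f v ∈ P ∧ t.f v - s.f v ∈ P)) → r.Hits E := by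
    rintro E hE ⟨v, hv, hne⟩
    by_cases h : t.f v - s.f v ∈ P
    · have h' : s.f v - t.f v ∉ P := fun h' => hne ⟨h', h⟩
      obtain ⟨w, hw, hws⟩ := meet_s E hE
      obtain ⟨u, hu, w, hw, hu', hw', huw⟩ := (hS E hE).2 {v | s.f v - t.f v ∉ P} ⟨v, hv, h'⟩
        ⟨w, hw, fun h => h hws⟩
      obtain ⟨e, he, rfl, rfl⟩ := Γ.exists_halfEdge_of_adj huw
      have hw'' := not_not.1 hw'
      exact hits_of_crossing hl t s r he hu hw ((tot _).resolve_left hu') hu' hw'' (a_t e hu')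
        (le_s _ hw'')
    · obtain ⟨w, hw, hwt⟩ := meet_t E hE
      obtain ⟨u, hu, w, hw, hu', hw', huw⟩ := (hS E hE).2 {v | t.f v - s.f v ∉ P} ⟨v, hv, h⟩
        ⟨w, hw, fun h => h hwt⟩
      obtain ⟨e, he, rfl, rfl⟩ := Γ.exists_halfEdge_of_adj huw
      have hw'' := not_not.1 hw'
      exact hits_of_crossing hl s t r he hu hw ((tot _).resolve_right hu') hu' hw'' (a_s e hu')
        (le_t _ hw'')
  refine ⟨r, fun E hE h => ?_, fun E hE h => ?_⟩
  · by_cases hE' : ∃ v ∈ E, ¬ (s.f v - t.f v ∈ P ∧ t.f v - s.f v ∈ P)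
    · exact hits E hE hE'
    push Not at hE'
    have tie : ∀ v ∈ E, s.f v - t.f v ∈ P ∧ t.f v - s.f v ∈ P := by simpa using hE'
    rcases h with ⟨v, hv, hpos⟩ | ⟨e, he, hu, hw, hpos⟩
    · exact Or.inl ⟨v, hv, hpos.trans_le (r.chip_mono s (le_s v (tie v hv).1))⟩
    · have h1 := le_s _ (tie _ hu).1
      have h2 := le_s _ (tie _ hw).1
      -- An interior chip of `s` either stays, or a slope decreases at one of the ends and a chip
      -- appears at that vertex.
      rcases (h1 e rfl).lt_or_eq with hlt | h1'
      · exact Or.inl ⟨_, hu, r.chip_pos s he h1 hlt⟩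
      rcases (h2 _ rfl).lt_or_eq with hlt | h2'
      · exact Or.inl ⟨_, hw, r.chip_pos s (i_i_ne he) h2 hlt⟩
      · exact Or.inr ⟨e, he, hu, hw, by rw [h1', h2']; exact hpos⟩
  · obtain ⟨v, hv, hpos⟩ := h
    by_cases hE' : s.f v - t.f v ∈ P ∧ t.f v - s.f v ∈ P
    · exact Or.inl ⟨v, hv, lt_of_lt_of_le hpos (r.chip_mono t (le_t v hE'.2))⟩
    · exact hits E hE ⟨v, hv, hE'⟩

end Chips

/-! ### Divisors of positive rank and the bound on gonality -/

variable [Subsingleton (AddUnits M)]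

/-- A divisor of positive rank is equivalent to an effective divisor with a chip at `v`. -/
theorem exists_chips_pos {Γ : MetrisedGraph X M} (hΓ : Γ.Connected)
    (P : AddSubmonoid (GrothendieckAddGroup M)) {D : Γ.Divisor} (hD : 1 ≤ rank D)
    (v : Γ.toHalfEdgeGraph.V) : ∃ s : Chips Γ P D, 0 < s.chip v := by
  -- The maximum `rank D` lies in `rankSet D` by definition, which avoids showing that `1` does; any
  -- positive number of chips at `v` suffices.
  have hdeg : deg (Γ := Γ) (Pi.single v (rank D)) = rank D := by
    rw [deg, Finset.sum_pi_single']
    simp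
  obtain ⟨E, ⟨g, hg, hE⟩, hE0⟩ := (isGreatest_rank hΓ D).1 (Pi.single v (rank D))
    (Pi.single_nonneg.2 (by omega)) hdeg
  have key : ∀ w, D w - ∑ e ∈ Γ.halfEdgesAt w, -Γ.slope g e =
      E w + Pi.single (M := fun _ => ℤ) v (rank D) w := by
    intro w
    have h := congrFun hE w
    simp only [Pi.sub_apply, laplacian] at h
    rw [Finset.sum_neg_distrib]
    omega
  have hsingle : ∀ w, 0 ≤ Pi.single (M := fun _ => ℤ) v (rank D) w := fun w => by
    rw [Pi.single_apply]
    split_ifs <;> omega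
  refine ⟨⟨fun w => -g w, fun e => -Γ.slope g e, fun e he => ?_, fun w => ?_⟩, ?_⟩
  · obtain ⟨n, hn⟩ := AddSubgroup.mem_zmultiples_iff.1 (hg e he)
    rw [Γ.slope_eq g he hn, neg_smul, hn]
    convert P.zero_mem using 1
    abel
  · have h1 := key w
    have h2 := hE0 w
    have h3 := hsingle w
    simp only [Pi.zero_apply] at h2
    omega
  · have h1 := key v
    have h2 := hE0 v
    simp only [Pi.zero_apply] at h2
    rw [Pi.single_eq_same] at h1
    change 0 < D v - ∑ e ∈ Γ.halfEdgesAt v, -Γ.slope g e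
    omega

theorem order_le_deg {Γ : MetrisedGraph X M} (hΓ : Γ.Connected) {D : Γ.Divisor}
    (hD : 1 ≤ rank D) (S : Γ.Scramble) : (S.order : ℤ) ≤ deg D := by
  by_contra! hlt
  obtain ⟨P, htot, hP⟩ := exists_total_cone M
  have hl : ∀ e, Γ.i e ≠ e → Γ.lengthGp e ∈ P ∧ -Γ.lengthGp e ∉ P := fun e he =>
    ⟨(hP _).1, (hP _).2 fun h => he ((Γ.l_eq_zero_iff e).1 h)⟩
  have hS : ∀ E ∈ S.eggs, Γ.adjGraph.ConnOn E := fun E hE =>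
    SimpleGraph.connOn_iff.2 (S.connected E hE)
  have hord := S.isGreatest_order.1
  have hcut : ∀ U : Set Γ.toHalfEdgeGraph.V, (∃ E ∈ S.eggs, E ⊆ U) → (∃ E ∈ S.eggs, E ⊆ Uᶜ) →
      deg D < Γ.cutSize U := fun U h1 h2 => hlt.trans_le (by exact_mod_cast hord.2 U h1 h2)
  obtain ⟨s₀, -⟩ := exists_chips_pos hΓ P hD hΓ.nonempty.some
  let hit : Chips Γ P D → Set (Set Γ.toHalfEdgeGraph.V) := fun s => {E | E ∈ S.eggs ∧ s.Hits E}
  -- There may be infinitely many configurations, but only finitely many sets of eggs that they hit.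
  obtain ⟨-, ⟨s, rfl⟩, hmax⟩ := (Set.toFinite (Set.range hit)).exists_maximal ⟨_, s₀, rfl⟩
  have hall : ∀ E ∈ S.eggs, s.Hits E := by
    intro E hE
    obtain ⟨v, hv⟩ := (hS E hE).1
    obtain ⟨t, ht⟩ := exists_chips_pos hΓ P hD v
    obtain ⟨r, hr, hr'⟩ := Chips.exists_join htot hl hS hcut s t
    have hle : hit s ≤ hit r := fun F hF => ⟨hF.1, hr F hF.1 hF.2⟩
    exact (hmax ⟨r, rfl⟩ hle ⟨hE, hr' E hE ⟨v, hv, ht⟩⟩).2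
  obtain ⟨C, hC, hcov⟩ := s.exists_cover hl
  have := hord.1 C fun E hE => hcov E (hall E hE)
  omega

theorem scrambleNumber_le_dgon {Γ : MetrisedGraph X M} (hΓ : Γ.Connected) :
    (Γ.scrambleNumber : ℤ) ≤ Γ.dgon := by
  obtain ⟨D, hD, hdeg⟩ := (isLeast_dgon hΓ).1
  obtain ⟨S, hS⟩ := Γ.isGreatest_scrambleNumber.1
  rw [← hdeg, ← hS]
  exact order_le_deg hΓ hD S

end MetrisedGraph

theorem corollary4p9 {X M : Type*} [Fintype X] [DecidableEq X]
    [AddCancelCommMonoid M] [Subsingleton (AddUnits M)]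
    (Γ : MetrisedGraph X M) (hΓ : Γ.toHalfEdgeGraph.Connected) :
    Γ.dgon ≥ (Γ.toHalfEdgeGraph.scrambleNumber : ℤ) ∧
      Γ.toHalfEdgeGraph.scrambleNumber ≥ Γ.toHalfEdgeGraph.treewidth :=
  ⟨MetrisedGraph.scrambleNumber_le_dgon hΓ, Γ.toHalfEdgeGraph.treewidth_le_scrambleNumber⟩
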